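/- Let $d\ge 1$ be an integer. Write $|\cdot|$ for the Euclidean norm on $\mathbb R^d$, $B(x,r)$ for the open ball with center $x$ and radius $r$, $\mathcal H_d$ for Lebesgue measure on $\mathbb R^d$, and $V_d$ for the volume of the unit ball of $\mathbb R^d$. * For a family $\mathcal B$ of unit balls in $\mathbb R^d$ its density is $\Delta(\mathcal B)=\lim_{R\to\infty}(2R)^{-d}\sum_{B\in\mathcal B}\mathcal H_d(B\cap[-R,R]^d)$, whenever this limit exists. The optimal covering density is $\Gamma_d=\inf\Delta(\mathcal B)$, the infimum being over all families $\mathcal B$ of unit balls that cover $\mathbb R^d$ and have a density. * For a nonempty compact set $A\subset\mathbb R^d$ and $r>0$, $N_A(r)$ is the least $N$ such that $A\subset\bigcup_{j=1}^N B(x_j,r)$ for some $x_1,\dots,x_N\in A$. * For $N\ge1$, $\rho_A(N)=\min_{x_1,\dots,x_N\in A}\ \max_{y\in A}\ \min_{1\le j\le N}|y-x_j|$. * For $s>0$, $\mathcal P_s(A;N)=\sup_{x_1,\dots,x_N\in A}\ \inf_{y\in A}\sum_{j=1}^N|y-x_j|^{-s}$ (with $|y-x_j|^{-s}=+\infty$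 if $y=x_j$), and for $s>d$, $\sigma_{s,d}=\lim_{N\to\infty}\mathcal P_s([0,1]^d;N)/N^{s/d}$. Then $0<\Gamma_d<\infty$; for every $s>d$ the limit $\sigma_{s,d}$ exists and $0<\sigma_{s,d}<\infty$; and all the limits below exist and satisfy $$\frac{\Gamma_d}{V_d}=\lim_{R\to\infty}\frac{N_{[-R,R]^d}(1)}{(2R)^d}=\lim_{r\to0^+}r^dN_{[0,1]^d}(r)=\lim_{N\to\infty}N\,\rho_{[0,1]^d}(N)^d=\lim_{s\to\infty}\sigma_{s,d}^{-d/s}.$$ -/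

import Mathlib

open Filter Topology MeasureTheory
open scoped ENNReal

namespace RieszCovering

noncomputable section

/-- The cube `[a, b]^d` in the Euclidean space `ℝ^d`. -/
def cube (d : ℕ) (a b : ℝ) : Set (EuclideanSpace ℝ (Fin d)) :=
  {x | ∀ i, x i ∈ Set.Icc a b}

/-- `P_s(A; ω) = inf_{y ∈ A} ∑_j |y - x_j|^{-s}` for the `N`-point configuration
`ω = (x_1, …, x_N)` in `A` (repetitions allowed). The sum is taken in `[0, ∞]`, so that
(for `s > 0`) the potential is `∞` at the points of the configuration. -/
def configPolarization {E : Type*} [MetricSpace E] (s : ℝ) (A : Set E) {N : ℕ}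
    (x : Fin N → A) : ℝ≥0∞ :=
  ⨅ y : A, ∑ j, 1 / edist (y : E) (x j : E) ^ s

/-- The `N`-th `s`-polarization constant `𝒫_s(A; N) = sup_{ω_N ⊂ A} P_s(A; ω_N)`. -/
def polarization {E : Type*} [MetricSpace E] (s : ℝ) (A : Set E) (N : ℕ) : ℝ≥0∞ :=
  ⨆ x : Fin N → A, configPolarization s A x

/-- The constant `σ_{s,d} = lim_{N → ∞} 𝒫_s([0,1]^d; N) / N^{s/d}`. -/
def sigma (s : ℝ) (d : ℕ) : ℝ≥0∞ :=
  limUnder atTop fun N : ℕ => polarization s (cube d 0 1) N / (N : ℝ≥0∞) ^ (s / (d : ℝ))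

/-- The covering radius `ρ_A(ω) = max_{y ∈ A} min_{x ∈ ω} |y - x|` of a configuration in `A`. -/
def configCoveringRadius {E : Type*} [MetricSpace E] (A : Set E) {N : ℕ} (x : Fin N → A) : ℝ :=
  ⨆ y : A, ⨅ j, dist (y : E) (x j : E)

/-- The best `N`-point covering radius `ρ_A(N) = min_{ω_N ⊂ A} ρ_A(ω_N)`. -/
def coveringRadius {E : Type*} [MetricSpace E] (A : Set E) (N : ℕ) : ℝ :=
  ⨅ x : Fin N → A, configCoveringRadius A x

/-- `N_A(r)`: the least number of open balls of radius `r` centered in `A` that cover `A`. -/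
def coveringCount {E : Type*} [MetricSpace E] (A : Set E) (r : ℝ) : ℕ :=
  sInf {N : ℕ | ∃ x : Fin N → E, (∀ j, x j ∈ A) ∧ A ⊆ ⋃ j, Metric.ball (x j) r}

/-- The family `{B(c, 1) : c ∈ C}` of unit balls has density
`D = lim_{R → ∞} (∑_{c ∈ C} vol (B(c,1) ∩ [-R,R]^d)) / (2R)^d`; in particular the limit exists. -/
def HasDensity {d : ℕ} (C : Set (EuclideanSpace ℝ (Fin d))) (D : ℝ≥0∞) : Prop :=
  Tendsto
    (fun R : ℝ =>
      (∑' c : C, volume (Metric.ball (c : EuclideanSpace ℝ (Fin d)) 1 ∩ cube d (-R) R)) /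
        ENNReal.ofReal ((2 * R) ^ d))
    atTop (𝓝 D)

/-- The optimal covering density `Γ_d` of `ℝ^d`: the infimum of the densities of all families of
unit balls that cover `ℝ^d` and have a density. -/
def optimalCoveringDensity (d : ℕ) : ℝ≥0∞ :=
  sInf {D : ℝ≥0∞ | ∃ C : Set (EuclideanSpace ℝ (Fin d)),
    (⋃ c ∈ C, Metric.ball c 1) = Set.univ ∧ HasDensity C D}

/-- The volume `V_d` of the closed unit ball of `ℝ^d`. -/
def unitBallVolume (d : ℕ) : ℝ≥0∞ :=
  volume (Metric.closedBall (0 : EuclideanSpace ℝ (Fin d)) 1)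

end

end RieszCovering

/-!
Let `N(r)` be the covering count of the unit cube. Cutting the cube into `k ^ d` cells shows
`N(r / k) ≤ k ^ d N(r)`, so `r ^ d N(r)` converges, as `r → 0`, to its infimum `θ`. Rescaling turns
this into the limits for large cubes and for the covering radius.

Restricting a family of unit balls that covers `ℝ ^ d` to a large cube gives a cover of the cube,
and moving its centers to their nearest points in the cube does not uncover anything; hence
`Γ_d ≥ θ V_d`. Conversely, optimal covers of a cube repeated periodically have density
`r ^ d N(r) V_d`, which tends to `θ V_d`.

The same subdivision makes `𝒫_s(N) / N ^ (s / d)` converge to its supremum `σ_{s,d}`. Evaluating at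
`N = N(r)` the polarization of an optimal cover gives `σ_{s,d} ≥ (r ^ d N(r)) ^ (-s / d)`, that is
`σ_{s,d} ^ (-d / s) ≤ θ`. For the reverse inequality as `s → ∞`, fix `q < θ` and let
`r = (q / N) ^ (1 / d)`. Then `N` balls of radius `r` fail to cover the cube, even when a small
proportion `δ N` of further balls is added. The points near which a configuration is crowded, in the
sense that `∑_j (1 + |y - x_j| / r) ^ (-t)` is large for a fixed `t > d`, can be covered by `δ N`
such balls, because that function has integral proportional to `N r ^ d`. So some point `y` is at
distance at least `r` from the whole configuration and not crowded, and there the `s`-potential is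
at most `K r ^ (-s)` with `K` independent of `s` and `N`; the factor `K ^ (-d / s)` tends to `1`.
-/

namespace RieszCovering

open scoped NNReal

/-! ### Covering counts in metric spaces -/

section CoveringCount

variable {E F ι : Type*} [MetricSpace E] [MetricSpace F] {A : Set E} {r : ℝ}

lemma coveringCount_le_card [Fintype ι] (x : ι → E) (hxA : ∀ i, x i ∈ A)
    (hx : A ⊆ ⋃ i, Metric.ball (x i) r) : coveringCount A r ≤ Fintype.card ι := by
  let e := (Fintype.equivFin ι).symm
  refine Nat.sInf_le ⟨x ∘ e, fun j => hxA _, hx.trans_eq ?_⟩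
  exact (e.surjective.iUnion_comp fun i => Metric.ball (x i) r).symm

lemma exists_cover (hA : TotallyBounded A) (hr : 0 < r) :
    ∃ x : Fin (coveringCount A r) → E, (∀ j, x j ∈ A) ∧ A ⊆ ⋃ j, Metric.ball (x j) r := by
  refine Nat.sInf_mem (s := {N : ℕ | ∃ x : Fin N → E, (∀ j, x j ∈ A) ∧
    A ⊆ ⋃ j, Metric.ball (x j) r}) ?_
  obtain ⟨t, htA, ht, hcover⟩ := Metric.finite_approx_of_totallyBounded hA r hr
  have := ht.fintype
  let e := (Fintype.equivFin t).symm
  refine ⟨Fintype.card t, fun j => e j, fun j => htA (e j).2, hcover.trans_eq ?_⟩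
  rw [Set.biUnion_eq_iUnion]
  exact (e.surjective.iUnion_comp fun x : t => Metric.ball (x : E) r).symm

lemma exists_config (hA : TotallyBounded A) (hne : A.Nonempty) (hr : 0 < r) {N : ℕ}
    (hN : coveringCount A r ≤ N) :
    ∃ x : Fin N → A, ∀ y ∈ A, ∃ j, dist y (x j : E) < r := by
  obtain ⟨x, hxA, hx⟩ := exists_cover hA hr
  have := hne.to_subtype
  refine ⟨Function.extend (Fin.castLE hN) (fun j => ⟨x j, hxA j⟩) fun _ => Classical.arbitrary A,
    fun y hy => ?_⟩
  obtain ⟨j, hj⟩ := Set.mem_iUnion.1 (hx hy)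
  refine ⟨Fin.castLE hN j, ?_⟩
  rwa [(Fin.castLE_injective hN).extend_apply]

lemma coveringCount_pos (hA : TotallyBounded A) (hne : A.Nonempty) (hr : 0 < r) :
    0 < coveringCount A r := by
  obtain ⟨x, -, hx⟩ := exists_cover hA hr
  obtain ⟨y, hy⟩ := hne
  obtain ⟨j, -⟩ := Set.mem_iUnion.1 (hx hy)
  exact j.pos

lemma coveringCount_antitoneOn (hA : TotallyBounded A) :
    AntitoneOn (coveringCount A) (Set.Ioi 0) := by
  intro r hr r' _ hrr'
  obtain ⟨x, hxA, hx⟩ := exists_cover hA hr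
  simpa using coveringCount_le_card x hxA
    (hx.trans (Set.iUnion_mono fun j => Metric.ball_subset_ball hrr'))

lemma coveringCount_iUnion_le [Fintype ι] {A : ι → Set E} (hA : ∀ i, TotallyBounded (A i))
    (hr : 0 < r) : coveringCount (⋃ i, A i) r ≤ ∑ i, coveringCount (A i) r := by
  choose x hxA hx using fun i => exists_cover (hA i) hr
  simpa using coveringCount_le_card (fun p : Σ i, Fin (coveringCount (A i) r) => x p.1 p.2)
    (fun p => Set.mem_iUnion_of_mem p.1 (hxA p.1 p.2))
    (Set.iUnion_subset fun i => (hx i).trans <|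
      Set.iUnion_subset fun j => Set.subset_iUnion_of_subset ⟨i, j⟩ le_rfl)

lemma coveringCount_image {f : E → F} {c : ℝ} (hc : 0 < c)
    (hf : ∀ x y, dist (f x) (f y) = c * dist x y) (A : Set E) (r : ℝ) :
    coveringCount (f '' A) (c * r) = coveringCount A r := by
  have hball (x y : E) : f y ∈ Metric.ball (f x) (c * r) ↔ y ∈ Metric.ball x r := by
    simp only [Metric.mem_ball, hf, mul_lt_mul_iff_right₀ hc]
  have hcover {N : ℕ} (x : Fin N → E) :
      f '' A ⊆ ⋃ j, Metric.ball (f (x j)) (c * r) ↔ A ⊆ ⋃ j, Metric.ball (x j) r := by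
    simp only [Set.subset_def, Set.forall_mem_image, Set.mem_iUnion, hball]
  unfold coveringCount
  congr 1
  ext N
  constructor
  · rintro ⟨z, hzA, hz⟩
    choose x hxA hxz using hzA
    obtain rfl : f ∘ x = z := funext hxz
    exact ⟨x, hxA, (hcover x).1 hz⟩
  · rintro ⟨x, hxA, hx⟩
    exact ⟨f ∘ x, fun j => Set.mem_image_of_mem f (hxA j), (hcover x).2 hx⟩

lemma measure_le_coveringCount_mul [MeasurableSpace E] (μ : Measure E) (hA : TotallyBounded A)
    (hr : 0 < r) {m : ℝ≥0∞} (hm : ∀ x ∈ A, μ (Metric.ball x r) ≤ m) :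
    μ A ≤ coveringCount A r * m := by
  obtain ⟨x, hxA, hx⟩ := exists_cover hA hr
  calc μ A ≤ ∑ j, μ (Metric.ball (x j) r) :=
        (measure_mono hx).trans (measure_iUnion_fintype_le μ _)
    _ ≤ ∑ _j : Fin (coveringCount A r), m := Finset.sum_le_sum fun j _ => hm _ (hxA j)
    _ = coveringCount A r * m := by simp

end CoveringCount

section Convex

variable {E : Type*} [NormedAddCommGroup E] [InnerProductSpace ℝ E] {K : Set E}

lemma exists_mem_forall_dist_le (hne : K.Nonempty) (hK : IsComplete K) (hconv : Convex ℝ K)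
    (x : E) : ∃ x' ∈ K, ∀ y ∈ K, dist y x' ≤ dist y x := by
  obtain ⟨x', hx', hmin⟩ := exists_norm_eq_iInf_of_complete_convex hne hK hconv x
  refine ⟨x', hx', fun y hy => ?_⟩
  have hobtuse := (norm_eq_iInf_iff_real_inner_le_zero hconv hx').1 hmin y hy
  have hexpand := norm_sub_sq_real (y - x') (x - x')
  rw [sub_sub_sub_cancel_right, real_inner_comm] at hexpand
  rw [dist_eq_norm, dist_eq_norm]
  refine le_of_sq_le_sq ?_ (norm_nonneg _)
  nlinarith [sq_nonneg ‖x - x'‖]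

lemma coveringCount_le_encard (hne : K.Nonempty) (hK : IsComplete K) (hconv : Convex ℝ K) {r : ℝ}
    {S : Set E} (hS : K ⊆ ⋃ x ∈ S, Metric.ball x r) : (coveringCount K r : ℕ∞) ≤ S.encard := by
  obtain hfin | hinf := S.finite_or_infinite
  · have := hfin.fintype
    choose p hpK hp using exists_mem_forall_dist_le hne hK hconv
    have hcover : K ⊆ ⋃ x : S, Metric.ball (p x) r := fun y hy => by
      obtain ⟨x, hx, hxy⟩ := Set.mem_iUnion₂.1 (hS hy)
      exact Set.mem_iUnion.2 ⟨⟨x, hx⟩, (hp x y hy).trans_lt hxy⟩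
    rw [← Set.coe_fintypeCard]
    exact_mod_cast coveringCount_le_card _ (fun x : S => hpK x) hcover
  · rw [hinf.encard_eq]
    exact le_top

end Convex

/-! ### Self-similar sets -/

section Polarization

variable {E ι : Type*} [MetricSpace E] {A : Set E}

lemma le_polarization [Fintype ι] (s : ℝ) (x : ι → A) :
    ⨅ y : A, ∑ i, 1 / edist (y : E) (x i : E) ^ s ≤ polarization s A (Fintype.card ι) := by
  let e := (Fintype.equivFin ι).symm
  refine (iInf_mono fun y => ?_).trans (le_iSup (configPolarization s A) (x ∘ e))
  exact (e.sum_comp fun i => 1 / edist (y : E) (x i : E) ^ s).ge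

lemma polarization_mono (hne : A.Nonempty) (s : ℝ) : Monotone (polarization s A) := by
  intro N M hNM
  have := hne.to_subtype
  refine iSup_le fun x => ?_
  let x' : Fin M → A := Function.extend (Fin.castLE hNM) x fun _ => Classical.arbitrary A
  refine (iInf_mono fun y => ?_).trans (le_iSup (configPolarization s A) x')
  have hx' (j : Fin N) : x' (Fin.castLE hNM j) = x j := (Fin.castLE_injective hNM).extend_apply ..
  calc ∑ j, 1 / edist (y : E) (x j : E) ^ s
      = ∑ j ∈ Finset.univ.map (Fin.castLEEmb hNM), 1 / edist (y : E) (x' j : E) ^ s := by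
        simp [hx']
    _ ≤ ∑ j, 1 / edist (y : E) (x' j : E) ^ s :=
        Finset.sum_le_sum_of_subset (Finset.subset_univ _)

lemma polarization_zero (hne : A.Nonempty) (s : ℝ) : polarization s A 0 = 0 := by
  have := hne.to_subtype
  simp [polarization, configPolarization]

end Polarization

/-- The set `A` is the union of its images under the maps `f i`, all of which are similarities of
ratio `c`. Unlike for the attractor of an iterated function system, `c < 1` is not required. -/
structure IsSelfSimilar {E ι : Type*} [MetricSpace E] (A : Set E) (c : ℝ) (f : ι → E → E) :
    Prop where
  dist_map : ∀ i x y, dist (f i x) (f i y) = c * dist x y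
  iUnion_image : ⋃ i, f i '' A = A

namespace IsSelfSimilar

variable {E ι : Type*} [MetricSpace E] {A : Set E} {c : ℝ} {f : ι → E → E}

lemma image_subset (h : IsSelfSimilar A c f) (i : ι) : f i '' A ⊆ A :=
  (Set.subset_iUnion (fun i => f i '' A) i).trans_eq h.iUnion_image

lemma coveringCount_mul_le [Fintype ι] (h : IsSelfSimilar A c f) (hA : TotallyBounded A)
    (hc : 0 < c) {r : ℝ} (hr : 0 < r) :
    coveringCount A (c * r) ≤ Fintype.card ι * coveringCount A r := by
  calc coveringCount A (c * r) = coveringCount (⋃ i, f i '' A) (c * r) := by rw [h.iUnion_image]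
    _ ≤ ∑ i, coveringCount (f i '' A) (c * r) :=
        coveringCount_iUnion_le (fun i => hA.subset (h.image_subset i)) (by positivity)
    _ = Fintype.card ι * coveringCount A r := by
        simp [coveringCount_image hc (h.dist_map _)]

lemma one_div_edist_rpow (h : IsSelfSimilar A c f) (hc : 0 < c) {s : ℝ} (hs : 0 ≤ s) (i : ι)
    (x y : E) :
    1 / edist (f i x) (f i y) ^ s = ENNReal.ofReal (c ^ (-s)) * (1 / edist x y ^ s) := by
  have hc0 : ENNReal.ofReal c ^ s ≠ 0 := by simp [ENNReal.rpow_eq_zero_iff, hc]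
  have hctop : ENNReal.ofReal c ^ s ≠ ⊤ := by finiteness
  rw [edist_dist, h.dist_map, ENNReal.ofReal_mul hc.le, ← edist_dist,
    ENNReal.mul_rpow_of_nonneg _ _ hs, one_div, ENNReal.mul_inv (.inl hc0) (.inl hctop), one_div,
    ← ENNReal.ofReal_rpow_of_pos hc, ENNReal.rpow_neg]

lemma mul_polarization_le [Fintype ι] (h : IsSelfSimilar A c f) (hc : 0 < c) {s : ℝ} (hs : 0 ≤ s)
    (N : ℕ) :
    ENNReal.ofReal (c ^ (-s)) * polarization s A N ≤ polarization s A (Fintype.card ι * N) := by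
  rw [polarization, ENNReal.mul_iSup]
  refine iSup_le fun x => ?_
  let x' (p : ι × Fin N) : A := ⟨f p.1 (x p.2), h.image_subset p.1 ⟨_, (x p.2).2, rfl⟩⟩
  have hcard : Fintype.card (ι × Fin N) = Fintype.card ι * N := by simp
  refine (le_iInf fun y => ?_).trans (hcard ▸ le_polarization s x')
  obtain ⟨i, z, hz, hzy⟩ := Set.mem_iUnion.1 (h.iUnion_image.ge y.2)
  calc ENNReal.ofReal (c ^ (-s)) * configPolarization s A x
      ≤ ENNReal.ofReal (c ^ (-s)) * ∑ j, 1 / edist z (x j : E) ^ s := by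
        gcongr
        exact iInf_le (fun z : A => ∑ j, 1 / edist (z : E) (x j : E) ^ s) ⟨z, hz⟩
    _ = ∑ j, 1 / edist (y : E) (x' (i, j) : E) ^ s := by
        simp only [Finset.mul_sum, x', ← hzy, h.one_div_edist_rpow hc hs]
    _ ≤ ∑ i, ∑ j, 1 / edist (y : E) (x' (i, j) : E) ^ s :=
        Finset.single_le_sum (f := fun i => ∑ j, 1 / edist (y : E) (x' (i, j) : E) ^ s)
          (fun _ _ => zero_le) (Finset.mem_univ i)
    _ = ∑ p, 1 / edist (y : E) (x' p : E) ^ s := Fintype.sum_prod_type' _ |>.symm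

end IsSelfSimilar

section Cube

variable {d : ℕ}

lemma cube_nonempty {a b : ℝ} (h : a ≤ b) : (cube d a b).Nonempty :=
  ⟨WithLp.toLp 2 fun _ => a, fun _ => ⟨le_rfl, h⟩⟩

lemma cube_eq_preimage (a b : ℝ) :
    cube d a b = (EuclideanSpace.equiv (Fin d) ℝ) ⁻¹' Set.Icc (fun _ => a) (fun _ => b) := by
  ext x
  simp [cube, Pi.le_def, forall_and]

lemma isCompact_cube (a b : ℝ) : IsCompact (cube d a b) := by
  rw [cube_eq_preimage]
  exact (EuclideanSpace.equiv (Fin d) ℝ).toHomeomorph.isCompact_preimage.2 isCompact_Icc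

lemma convex_cube (a b : ℝ) : Convex ℝ (cube d a b) := by
  rw [cube_eq_preimage]
  exact (convex_Icc _ _).linear_preimage (EuclideanSpace.equiv (Fin d) ℝ).toLinearMap

lemma volume_cube (a b : ℝ) : volume (cube d a b) = ENNReal.ofReal (b - a) ^ d := by
  have hpres := (PiLp.volume_preserving_ofLp (Fin d)).measure_preimage
    (measurableSet_Icc (a := fun _ : Fin d => a) (b := fun _ => b)).nullMeasurableSet
  rw [cube_eq_preimage]
  exact hpres.trans (by simp [Real.volume_Icc_pi])

lemma image_smul_add_cube {c : ℝ} (hc : 0 < c) (v a b : ℝ) :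
    (fun x => c • x + WithLp.toLp 2 fun _ => v) '' cube d a b =
      cube d (c * a + v) (c * b + v) := by
  ext y
  constructor
  · rintro ⟨x, hx, rfl⟩ i
    simpa [hc] using hx i
  · intro hy
    refine ⟨c⁻¹ • (y - WithLp.toLp 2 fun _ => v), fun i => ?_, ?_⟩
    · simpa [le_inv_mul_iff₀ hc, inv_mul_le_iff₀ hc, le_sub_iff_add_le] using hy i
    · simp [smul_inv_smul₀ hc.ne']

lemma coveringCount_cube {a b : ℝ} (h : a < b) (r : ℝ) :
    coveringCount (cube d a b) r = coveringCount (cube d 0 1) (r / (b - a)) := by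
  have hba : 0 < b - a := sub_pos.2 h
  let f (x : EuclideanSpace ℝ (Fin d)) := (b - a) • x + WithLp.toLp 2 fun _ => a
  have hdist (x y : EuclideanSpace ℝ (Fin d)) : dist (f x) (f y) = (b - a) * dist x y := by
    rw [dist_add_right, dist_smul₀, Real.norm_of_nonneg hba.le]
  have himage : f '' cube d 0 1 = cube d a b := by
    simpa using image_smul_add_cube (d := d) hba a 0 1
  have hcount := coveringCount_image hba hdist (cube d 0 1) (r / (b - a))
  rwa [himage, mul_div_cancel₀ _ hba.ne'] at hcount

lemma exists_sub_mem_Icc_iff {k : ℕ} (hk : k ≠ 0) {t : ℝ} :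
    (∃ j : Fin k, k * t - j ∈ Set.Icc (0 : ℝ) 1) ↔ t ∈ Set.Icc (0 : ℝ) 1 := by
  have hk' : (0 : ℝ) < k := by positivity
  constructor
  · rintro ⟨j, hj0, hj1⟩
    have hj : (j : ℝ) + 1 ≤ k := by exact_mod_cast j.2
    have hj' : (0 : ℝ) ≤ j := by positivity
    constructor <;> nlinarith [hj']
  · rintro ⟨ht0, ht1⟩
    obtain rfl | ht1 := ht1.eq_or_lt
    · refine ⟨⟨k - 1, by omega⟩, ?_⟩
      simp [Nat.cast_sub (Nat.one_le_iff_ne_zero.2 hk)]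
    · have hkt : 0 ≤ k * t := by positivity
      refine ⟨⟨⌊k * t⌋₊, (Nat.floor_lt hkt).2 (by nlinarith)⟩, ?_⟩
      exact ⟨sub_nonneg.2 (Nat.floor_le hkt),
        (sub_lt_iff_lt_add'.2 (Nat.lt_floor_add_one _)).le⟩

/-- The similarity of ratio `k⁻¹` that maps the unit cube onto the cell with index `z` of its
subdivision into `k ^ d` cubes of side `k⁻¹`. -/
noncomputable def subcubeMap (d k : ℕ) (z : Fin d → Fin k) (x : EuclideanSpace ℝ (Fin d)) :
    EuclideanSpace ℝ (Fin d) :=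
  (k : ℝ)⁻¹ • (x + WithLp.toLp 2 fun i => (z i : ℝ))

lemma isSelfSimilar_cube {k : ℕ} (hk : k ≠ 0) :
    IsSelfSimilar (cube d 0 1) (k : ℝ)⁻¹ (subcubeMap d k) where
  dist_map z x y := by
    rw [subcubeMap, subcubeMap, dist_smul₀, dist_add_right, Real.norm_of_nonneg (by positivity)]
  iUnion_image := by
    have hk' : (k : ℝ) ≠ 0 := by exact_mod_cast hk
    have hinv (z : Fin d → Fin k) (x y : EuclideanSpace ℝ (Fin d)) :
        subcubeMap d k z x = y ↔ (k : ℝ) • y - WithLp.toLp 2 (fun i => (z i : ℝ)) = x := by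
      rw [subcubeMap, inv_smul_eq_iff₀ hk', ← eq_sub_iff_add_eq, eq_comm]
    ext y
    simp only [Set.mem_iUnion, Set.mem_image, hinv, exists_eq_right']
    exact Classical.skolem.symm.trans (forall_congr' fun i => exists_sub_mem_Icc_iff hk)

lemma totallyBounded_cube (a b : ℝ) : TotallyBounded (cube d a b) :=
  (isCompact_cube a b).totallyBounded

end Cube

/-! ### Limits from scaling inequalities -/

section ScalingLimits

lemma pow_mul_le_of_scaling {n : ℝ → ℝ} {d : ℕ} (hn : ∀ r, 0 ≤ n r)
    (hanti : AntitoneOn n (Set.Ioi 0))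
    (hscale : ∀ k : ℕ, k ≠ 0 → ∀ r > 0, n ((k : ℝ)⁻¹ * r) ≤ k ^ d * n r)
    {r r' : ℝ} (hr : 0 < r) (hr' : 0 < r') : r ^ d * n r ≤ (r' + r) ^ d * n r' := by
  set k := ⌈r' / r⌉₊
  have hk : 0 < k := Nat.ceil_pos.2 (by positivity)
  have hkr : (k : ℝ)⁻¹ * r' ≤ r := by
    rw [inv_mul_le_iff₀ (by positivity), ← div_le_iff₀ hr]
    exact Nat.le_ceil _
  have hrk : r * k ≤ r' + r := by
    calc r * k ≤ r * (r' / r + 1) := by gcongr; exact (Nat.ceil_lt_add_one (by positivity)).le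
      _ = r' + r := by field_simp
  calc r ^ d * n r ≤ r ^ d * n ((k : ℝ)⁻¹ * r') := by
        gcongr
        exact hanti (Set.mem_Ioi.2 (by positivity)) hr hkr
    _ ≤ r ^ d * (k ^ d * n r') := by gcongr; exact hscale k hk.ne' r' hr'
    _ = (r * k) ^ d * n r' := by ring
    _ ≤ (r' + r) ^ d * n r' := by gcongr; exact hn r'

lemma tendsto_pow_mul_iInf_of_scaling {n : ℝ → ℝ} {d : ℕ} (hn : ∀ r, 0 ≤ n r)
    (hanti : AntitoneOn n (Set.Ioi 0))
    (hscale : ∀ k : ℕ, k ≠ 0 → ∀ r > 0, n ((k : ℝ)⁻¹ * r) ≤ k ^ d * n r) :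
    Tendsto (fun r => r ^ d * n r) (𝓝[>] 0) (𝓝 (⨅ r : Set.Ioi (0 : ℝ), (r : ℝ) ^ d * n r)) := by
  have hbdd : BddBelow (Set.range fun r : Set.Ioi (0 : ℝ) => (r : ℝ) ^ d * n r) :=
    ⟨0, Set.forall_mem_range.2 fun r => mul_nonneg (pow_nonneg r.2.le d) (hn r)⟩
  refine tendsto_order.2 ⟨fun c hc => ?_, fun c hc => ?_⟩
  · filter_upwards [self_mem_nhdsWithin] with r hr
    exact hc.trans_le (ciInf_le hbdd ⟨r, hr⟩)
  · obtain ⟨⟨r', hr'⟩, hlt⟩ := exists_lt_of_ciInf_lt hc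
    have hlim : Tendsto (fun r : ℝ => (r' + r) ^ d * n r') (𝓝[>] 0) (𝓝 ((r' + 0) ^ d * n r')) :=
      (Continuous.tendsto (by fun_prop) 0).mono_left nhdsWithin_le_nhds
    rw [add_zero] at hlim
    filter_upwards [self_mem_nhdsWithin, hlim.eventually_lt_const hlt] with r hr hlt
    exact (pow_mul_le_of_scaling hn hanti hscale hr hr').trans_lt hlt

lemma natCast_rpow {N : ℕ} (hN : 0 < N) (p : ℝ) :
    (N : ℝ≥0∞) ^ p = ENNReal.ofReal ((N : ℝ) ^ p) := by
  rw [← ENNReal.ofReal_rpow_of_pos (by exact_mod_cast hN), ENNReal.ofReal_natCast]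

lemma floor_div_rpow_mul_le_of_scaling {p : ℕ → ℝ≥0∞} {d : ℕ} (hd : d ≠ 0) {s : ℝ}
    (hmono : Monotone p)
    (hscale : ∀ k : ℕ, k ≠ 0 → ∀ M, ENNReal.ofReal ((k : ℝ) ^ s) * p M ≤ p (k ^ d * M))
    {M N : ℕ} (hM : 0 < M) (hMN : M ≤ N) {u : ℝ} (hu : u = ((N : ℝ) / M) ^ (d : ℝ)⁻¹) :
    ENNReal.ofReal ((⌊u⌋₊ / u) ^ s) * (p M / (M : ℝ≥0∞) ^ (s / d)) ≤
      p N / (N : ℝ≥0∞) ^ (s / d) := by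
  have hN : 0 < N := hM.trans_le hMN
  have hM' : (0 : ℝ) < M := by exact_mod_cast hM
  have hu1 : 1 ≤ u := hu ▸ Real.one_le_rpow ((one_le_div hM').2 (by exact_mod_cast hMN))
    (by positivity)
  have hu0 : 0 < u := by positivity
  have hk : 0 < ⌊u⌋₊ := Nat.floor_pos.2 hu1
  have hud : u ^ d = N / M := hu ▸ Real.rpow_inv_natCast_pow (by positivity) hd
  have hkN : ⌊u⌋₊ ^ d * M ≤ N := by
    have : (⌊u⌋₊ : ℝ) ^ d * M ≤ N := by
      rw [← le_div_iff₀ hM', ← hud]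
      gcongr
      exact Nat.floor_le hu0.le
    exact_mod_cast this
  have hus : u ^ s * (M : ℝ) ^ (s / d) = (N : ℝ) ^ (s / d) := by
    rw [hu, ← Real.rpow_mul (by positivity), inv_mul_eq_div,
      ← Real.mul_rpow (by positivity) (by positivity), div_mul_cancel₀ _ hM'.ne']
  calc ENNReal.ofReal ((⌊u⌋₊ / u) ^ s) * (p M / (M : ℝ≥0∞) ^ (s / d))
      = ENNReal.ofReal ((⌊u⌋₊ : ℝ) ^ s) * p M / (N : ℝ≥0∞) ^ (s / d) := by
        rw [natCast_rpow hM, natCast_rpow hN, ← hus, Real.div_rpow (by positivity) hu0.le,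
          ENNReal.ofReal_div_of_pos (by positivity), ENNReal.ofReal_mul (by positivity)]
        simp only [div_eq_mul_inv]
        rw [ENNReal.mul_inv (Or.inr (by finiteness)) (Or.inl (by finiteness))]
        ring
    _ ≤ p N / (N : ℝ≥0∞) ^ (s / d) := by
        gcongr
        exact (hscale _ hk.ne' M).trans (hmono hkN)

lemma tendsto_div_rpow_iSup_of_scaling {p : ℕ → ℝ≥0∞} {d : ℕ} (hd : d ≠ 0) {s : ℝ} (hs : 0 ≤ s)
    (hp : p 0 = 0) (hmono : Monotone p)
    (hscale : ∀ k : ℕ, k ≠ 0 → ∀ M, ENNReal.ofReal ((k : ℝ) ^ s) * p M ≤ p (k ^ d * M)) :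
    Tendsto (fun N : ℕ => p N / (N : ℝ≥0∞) ^ (s / (d : ℝ))) atTop
      (𝓝 (⨆ N : ℕ, p N / (N : ℝ≥0∞) ^ (s / (d : ℝ)))) := by
  refine tendsto_order.2 ⟨fun c hc => ?_, fun c hc => Eventually.of_forall fun N =>
    (le_iSup (fun N : ℕ => p N / (N : ℝ≥0∞) ^ (s / (d : ℝ))) N).trans_lt hc⟩
  obtain ⟨M, hcM⟩ := lt_iSup_iff.1 hc
  have hM : 0 < M := Nat.pos_of_ne_zero fun h0 => by simp [h0, hp] at hcM
  have hu : Tendsto (fun N : ℕ => ((N : ℝ) / M) ^ (d : ℝ)⁻¹) atTop atTop :=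
    (tendsto_rpow_atTop (by positivity)).comp
      (tendsto_natCast_atTop_atTop.atTop_div_const (by positivity))
  have hfloor : Tendsto (fun N : ℕ => ENNReal.ofReal
      (((⌊((N : ℝ) / M) ^ (d : ℝ)⁻¹⌋₊ : ℝ) / ((N : ℝ) / M) ^ (d : ℝ)⁻¹) ^ s)) atTop
      (𝓝 (ENNReal.ofReal (1 ^ s))) :=
    ENNReal.tendsto_ofReal
      (((tendsto_nat_floor_div_atTop (R := ℝ)).comp hu).rpow_const (Or.inr hs))
  have hlim := ENNReal.Tendsto.mul_const (b := p M / (M : ℝ≥0∞) ^ (s / (d : ℝ))) hfloor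
    (Or.inl (by simp))
  rw [Real.one_rpow, ENNReal.ofReal_one, one_mul] at hlim
  filter_upwards [hlim.eventually_const_lt hcM, eventually_ge_atTop M] with N hcN hMN
  exact hcN.trans_le (floor_div_rpow_mul_le_of_scaling hd hmono hscale hM hMN rfl)

end ScalingLimits

section CoveringConstant

variable {d : ℕ}

/-- The limit `θ` of `r ^ d * N_{[0,1]^d}(r)` as `r → 0`, which is `Γ_d / V_d`; by self-similarity
it is an infimum. -/
noncomputable def coveringConstant (d : ℕ) : ℝ :=
  ⨅ r : Set.Ioi (0 : ℝ), (r : ℝ) ^ d * (coveringCount (cube d 0 1) r : ℝ)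

lemma coveringConstant_le {r : ℝ} (hr : 0 < r) :
    coveringConstant d ≤ r ^ d * (coveringCount (cube d 0 1) r : ℝ) := by
  refine ciInf_le ⟨0, Set.forall_mem_range.2 fun t => ?_⟩ (⟨r, hr⟩ : Set.Ioi (0 : ℝ))
  exact mul_nonneg (pow_nonneg (Set.mem_Ioi.1 t.2).le d) (Nat.cast_nonneg _)

lemma tendsto_coveringCount :
    Tendsto (fun r : ℝ => r ^ d * (coveringCount (cube d 0 1) r : ℝ)) (𝓝[>] 0)
      (𝓝 (coveringConstant d)) := by
  refine tendsto_pow_mul_iInf_of_scaling (fun r => Nat.cast_nonneg _) (fun r hr r' hr' hrr' => ?_)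
    fun k hk r hr => ?_
  · exact_mod_cast coveringCount_antitoneOn (totallyBounded_cube 0 1) hr hr' hrr'
  · have := (isSelfSimilar_cube (d := d) hk).coveringCount_mul_le (totallyBounded_cube 0 1)
      (by positivity) hr
    simp only [Fintype.card_pi_const, Fintype.card_fin] at this
    exact_mod_cast this

lemma tendsto_coveringCount_cube :
    Tendsto (fun R : ℝ => (coveringCount (cube d (-R) R) 1 : ℝ) / (2 * R) ^ d) atTop
      (𝓝 (coveringConstant d)) := by
  have h : Tendsto (fun R : ℝ => (2 * R)⁻¹) atTop (𝓝[>] 0) :=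
    tendsto_inv_atTop_nhdsGT_zero.comp (tendsto_id.const_mul_atTop two_pos)
  refine (tendsto_coveringCount.comp h).congr' ?_
  filter_upwards [eventually_gt_atTop 0] with R hR
  rw [Function.comp, coveringCount_cube (neg_lt_self hR), sub_neg_eq_add, ← two_mul, one_div,
    inv_pow, inv_mul_eq_div]

lemma coveringConstant_pos : 0 < coveringConstant d := by
  set V := volume.real (Metric.ball (0 : EuclideanSpace ℝ (Fin d)) 1)
  have hV : 0 < V := ENNReal.toReal_pos (Metric.measure_ball_pos _ _ one_pos).ne'
    measure_ball_lt_top.ne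
  refine lt_of_lt_of_le (inv_pos.2 hV) (le_ciInf fun ⟨r, (hr : 0 < r)⟩ => ?_)
  have hcount : volume (cube d 0 1) ≤ coveringCount (cube d 0 1) r *
      (ENNReal.ofReal (r ^ d) * volume (Metric.ball (0 : EuclideanSpace ℝ (Fin d)) 1)) :=
    measure_le_coveringCount_mul _ (totallyBounded_cube 0 1) hr fun x _ => by
      rw [Measure.addHaar_ball_of_pos _ _ hr, finrank_euclideanSpace_fin]
  rw [volume_cube] at hcount
  have hreal := ENNReal.toReal_mono (by finiteness) hcount
  simp only [sub_zero, ENNReal.ofReal_one, one_pow, ENNReal.toReal_one, ENNReal.toReal_mul,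
    ENNReal.toReal_natCast, ENNReal.toReal_ofReal (pow_nonneg hr.le d)] at hreal
  rw [inv_le_iff_one_le_mul₀ hV]
  exact hreal.trans_eq (by simp only [V, Measure.real]; ring)

end CoveringConstant

/-! ### Covering radii -/

section CoveringRadius

variable {E : Type*} [MetricSpace E] {A : Set E} {N : ℕ} {r : ℝ}

lemma configCoveringRadius_nonneg (x : Fin N → A) : 0 ≤ configCoveringRadius A x :=
  Real.iSup_nonneg fun _ => Real.iInf_nonneg fun _ => dist_nonneg

lemma coveringRadius_nonneg : 0 ≤ coveringRadius A N :=
  Real.iInf_nonneg configCoveringRadius_nonneg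

lemma iInf_dist_le (x : Fin N → A) (y : A) (j : Fin N) :
    ⨅ j, dist (y : E) (x j : E) ≤ dist (y : E) (x j : E) :=
  ciInf_le ⟨0, Set.forall_mem_range.2 fun _ => dist_nonneg⟩ j

lemma coveringRadius_le (hA : TotallyBounded A) (hne : A.Nonempty) (hr : 0 < r)
    (hN : coveringCount A r ≤ N) : coveringRadius A N ≤ r := by
  obtain ⟨x, hx⟩ := exists_config hA hne hr hN
  refine (ciInf_le ⟨0, Set.forall_mem_range.2 configCoveringRadius_nonneg⟩ x).trans ?_
  refine Real.iSup_le (fun y => ?_) hr.le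
  obtain ⟨j, hj⟩ := hx y y.2
  exact (iInf_dist_le x y j).trans hj.le

lemma le_coveringRadius (hA : Bornology.IsBounded A) (hne : A.Nonempty) (hN : 0 < N)
    (h : N < coveringCount A r) : r ≤ coveringRadius A N := by
  have := hne.to_subtype
  have : Nonempty (Fin N) := ⟨⟨0, hN⟩⟩
  by_contra! hlt
  obtain ⟨x, hx⟩ := exists_lt_of_ciInf_lt hlt
  obtain ⟨C, hC⟩ := Metric.isBounded_iff.1 hA
  have hbdd : BddAbove (Set.range fun y : A => ⨅ j, dist (y : E) (x j : E)) :=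
    ⟨C, Set.forall_mem_range.2 fun y => (iInf_dist_le x y ⟨0, hN⟩).trans (hC y.2 (x _).2)⟩
  have hcover : A ⊆ ⋃ j, Metric.ball (x j : E) r := fun y hy => by
    obtain ⟨j, hj⟩ := exists_lt_of_ciInf_lt ((le_ciSup hbdd ⟨y, hy⟩).trans_lt hx)
    exact Set.mem_iUnion.2 ⟨j, hj⟩
  have hcard := coveringCount_le_card _ (fun j => (x j).2) hcover
  rw [Fintype.card_fin] at hcard
  omega

lemma tendsto_root {d : ℕ} (hd : d ≠ 0) {c : ℝ} (hc : 0 < c) :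
    Tendsto (fun N : ℕ => (c / N) ^ (d : ℝ)⁻¹) atTop (𝓝[>] 0) := by
  refine tendsto_nhdsWithin_iff.2 ⟨?_, ?_⟩
  · have hroot := (tendsto_const_div_atTop_nhds_zero_nat c).rpow_const (p := (d : ℝ)⁻¹)
      (Or.inr (by positivity))
    rwa [Real.zero_rpow (by positivity)] at hroot
  · filter_upwards [eventually_gt_atTop 0] with N hN
    exact Real.rpow_pos_of_pos (by positivity) _

/-- For large `N`, the covering number at the radius `r` with `N * r ^ d = c` decides on which side
of `c` the quantity `N * ρ_A(N) ^ d` lies. -/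
lemma eventually_exists_mul_pow_eq {d : ℕ} (hd : d ≠ 0) {c : ℝ} (hc : 0 < c) {p : ℝ → Prop}
    (hp : ∀ᶠ r in 𝓝[>] 0, p r) :
    ∀ᶠ N : ℕ in atTop, 0 < N ∧ ∃ r > 0, (N : ℝ) * r ^ d = c ∧ p r := by
  filter_upwards [eventually_gt_atTop 0, (tendsto_root hd hc).eventually hp,
    (tendsto_root hd hc).eventually self_mem_nhdsWithin] with N hN hpN hr
  refine ⟨hN, _, hr, ?_, hpN⟩
  rw [Real.rpow_inv_natCast_pow (by positivity) hd]
  field_simp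

theorem tendsto_mul_coveringRadius_pow (hA : TotallyBounded A) (hne : A.Nonempty) {d : ℕ}
    (hd : d ≠ 0) {θ : ℝ}
    (h : Tendsto (fun r : ℝ => r ^ d * (coveringCount A r : ℝ)) (𝓝[>] 0) (𝓝 θ)) :
    Tendsto (fun N : ℕ => (N : ℝ) * coveringRadius A N ^ d) atTop (𝓝 θ) := by
  have hθ : 0 ≤ θ := ge_of_tendsto h <| by
    filter_upwards [self_mem_nhdsWithin] with r (hr : 0 < r)
    positivity
  have hnonneg (N : ℕ) : 0 ≤ (N : ℝ) * coveringRadius A N ^ d :=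
    mul_nonneg N.cast_nonneg (pow_nonneg coveringRadius_nonneg d)
  refine tendsto_order.2 ⟨fun c hc => ?_, fun c hc => ?_⟩
  · obtain hc0 | hc0 := lt_or_ge c 0
    · exact Eventually.of_forall fun N => hc0.trans_le (hnonneg N)
    obtain ⟨c', hcc', hc'⟩ := exists_between hc
    filter_upwards [eventually_exists_mul_pow_eq hd (hc0.trans_lt hcc') (h.eventually_const_lt hc')]
      with N ⟨hN, r, hr, hNr, hlt⟩
    have hcount : N < coveringCount A r := by
      rw [← hNr, mul_comm, mul_lt_mul_iff_right₀ (by positivity)] at hlt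
      exact_mod_cast hlt
    calc c < N * r ^ d := hNr ▸ hcc'
      _ ≤ N * coveringRadius A N ^ d := by
        gcongr
        exact le_coveringRadius hA.isBounded hne hN hcount
  · obtain ⟨c', hc', hcc'⟩ := exists_between hc
    filter_upwards [eventually_exists_mul_pow_eq hd (hθ.trans_lt hc') (h.eventually_lt_const hc')]
      with N ⟨hN, r, hr, hNr, hlt⟩
    have hcount : coveringCount A r ≤ N := by
      rw [← hNr, mul_comm (N : ℝ), mul_lt_mul_iff_right₀ (by positivity)] at hlt
      exact_mod_cast hlt.le
    calc N * coveringRadius A N ^ d ≤ N * r ^ d := by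
          gcongr
          · exact coveringRadius_nonneg
          · exact coveringRadius_le hA hne hr hcount
      _ < c := hNr ▸ hcc'

end CoveringRadius

/-! ### Densities of families of unit balls -/

section Density

variable {d : ℕ}

lemma volume_ball_one (x : EuclideanSpace ℝ (Fin d)) :
    volume (Metric.ball x 1) = unitBallVolume d := by
  rw [unitBallVolume, Measure.addHaar_unitClosedBall_eq_addHaar_unitBall,
    Measure.addHaar_ball_center]

lemma unitBallVolume_ne_zero : unitBallVolume d ≠ 0 :=
  (Metric.measure_closedBall_pos _ _ one_pos).ne'

lemma unitBallVolume_ne_top : unitBallVolume d ≠ ⊤ :=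
  measure_closedBall_lt_top.ne

lemma mem_cube_of_dist_lt {R r : ℝ} {x y : EuclideanSpace ℝ (Fin d)}
    (hx : x ∈ cube d (-R) R) (hxy : dist x y < r) : y ∈ cube d (-(R + r)) (R + r) := by
  intro i
  have hdist : |x i - y i| ≤ r :=
    (PiLp.norm_apply_le (x - y) i).trans ((dist_eq_norm x y).ge.trans hxy.le)
  obtain ⟨hlo, hhi⟩ := abs_le.1 hdist
  exact ⟨by linarith [(hx i).1], by linarith [(hx i).2]⟩

lemma encard_mul_unitBallVolume_le_tsum (C : Set (EuclideanSpace ℝ (Fin d))) (R : ℝ) :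
    ((C ∩ cube d (-R) R).encard : ℝ≥0∞) * unitBallVolume d ≤
      ∑' c : C, volume (Metric.ball (c : EuclideanSpace ℝ (Fin d)) 1 ∩
        cube d (-(R + 1)) (R + 1)) := by
  calc ((C ∩ cube d (-R) R).encard : ℝ≥0∞) * unitBallVolume d
      = ∑' c : ↥(C ∩ cube d (-R) R), volume (Metric.ball (c : EuclideanSpace ℝ (Fin d)) 1 ∩
          cube d (-(R + 1)) (R + 1)) := by
        rw [← ENNReal.tsum_set_const]
        refine tsum_congr fun c => ?_
        rw [Set.inter_eq_left.2, volume_ball_one]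
        exact fun y hy => mem_cube_of_dist_lt c.2.2 (Metric.mem_ball'.1 hy)
    _ ≤ _ := ENNReal.tsum_mono_subtype
        (fun c => volume (Metric.ball c 1 ∩ cube d (-(R + 1)) (R + 1))) Set.inter_subset_left

lemma tsum_le_encard_mul_unitBallVolume (C : Set (EuclideanSpace ℝ (Fin d))) (R : ℝ) :
    ∑' c : C, volume (Metric.ball (c : EuclideanSpace ℝ (Fin d)) 1 ∩ cube d (-R) R) ≤
      ((C ∩ cube d (-(R + 1)) (R + 1)).encard : ℝ≥0∞) * unitBallVolume d := by
  rw [← ENNReal.tsum_set_const, tsum_subtype C fun c => volume (Metric.ball c 1 ∩ cube d (-R) R),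
    tsum_subtype (C ∩ cube d (-(R + 1)) (R + 1)) fun _ => unitBallVolume d]
  refine ENNReal.tsum_le_tsum fun c => ?_
  by_cases hc : c ∈ C ∩ cube d (-(R + 1)) (R + 1)
  · rw [Set.indicator_of_mem hc, Set.indicator_of_mem hc.1, ← volume_ball_one c]
    exact measure_mono Set.inter_subset_left
  · refine Set.indicator_apply_le' (fun hcC => ?_) fun _ => zero_le
    have hempty : Metric.ball c 1 ∩ cube d (-R) R = ∅ := Set.eq_empty_of_forall_notMem
      fun y hy => hc ⟨hcC, mem_cube_of_dist_lt hy.2 hy.1⟩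
    rw [hempty, measure_empty]
    exact zero_le

lemma tendsto_comp_add_div {f : ℝ → ℝ≥0∞} {D : ℝ≥0∞}
    (h : Tendsto (fun R : ℝ => f R / ENNReal.ofReal ((2 * R) ^ d)) atTop (𝓝 D)) (e : ℝ) :
    Tendsto (fun R : ℝ => f (R + e) / ENNReal.ofReal ((2 * R) ^ d)) atTop (𝓝 D) := by
  have hratio : Tendsto (fun R : ℝ => (1 + e * R⁻¹) ^ d) atTop (𝓝 ((1 + e * 0) ^ d)) :=
    ((tendsto_inv_atTop_zero.const_mul e).const_add 1).pow d
  rw [mul_zero, add_zero, one_pow] at hratio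
  have hmul := ENNReal.Tendsto.mul (h.comp (tendsto_atTop_add_const_right _ e tendsto_id))
    (.inr ENNReal.ofReal_ne_top) (ENNReal.tendsto_ofReal hratio) (.inl (by simp))
  rw [ENNReal.ofReal_one, mul_one] at hmul
  refine hmul.congr' ?_
  filter_upwards [eventually_gt_atTop 0, eventually_gt_atTop (-e)] with R hR hRe
  have hRe : 0 < R + e := by linarith
  have hsplit : (1 + e * R⁻¹) ^ d = (2 * (R + e)) ^ d / (2 * R) ^ d := by
    rw [← div_pow]
    congr 1
    field_simp
  rw [Function.comp, hsplit, ENNReal.ofReal_div_of_pos (by positivity), ← mul_div_assoc, id,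
    ENNReal.div_mul_cancel (ENNReal.ofReal_pos.2 (by positivity)).ne' (by finiteness)]

/-- The points of `C` have `δ` as their asymptotic number per unit volume. -/
def HasNumberDensity (C : Set (EuclideanSpace ℝ (Fin d))) (δ : ℝ≥0∞) : Prop :=
  Tendsto (fun R : ℝ => ((C ∩ cube d (-R) R).encard : ℝ≥0∞) / ENNReal.ofReal ((2 * R) ^ d))
    atTop (𝓝 δ)

lemma hasNumberDensity_empty : HasNumberDensity (∅ : Set (EuclideanSpace ℝ (Fin d))) 0 := by
  simp [HasNumberDensity]

lemma HasNumberDensity.union {C C' : Set (EuclideanSpace ℝ (Fin d))} {δ δ' : ℝ≥0∞}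
    (hC : HasNumberDensity C δ) (hC' : HasNumberDensity C' δ') (hdisj : Disjoint C C') :
    HasNumberDensity (C ∪ C') (δ + δ') := by
  refine (Tendsto.add hC hC').congr fun R => ?_
  rw [← ENNReal.add_div, ← ENat.toENNReal_add, Set.union_inter_distrib_right,
    Set.encard_union_eq (hdisj.mono Set.inter_subset_left Set.inter_subset_left)]

lemma HasNumberDensity.hasDensity {C : Set (EuclideanSpace ℝ (Fin d))} {δ : ℝ≥0∞}
    (h : HasNumberDensity C δ) : HasDensity C (δ * unitBallVolume d) := by
  have hshift (e : ℝ) : Tendsto (fun R : ℝ =>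
      ((C ∩ cube d (-(R + e)) (R + e)).encard : ℝ≥0∞) * unitBallVolume d /
        ENNReal.ofReal ((2 * R) ^ d)) atTop (𝓝 (δ * unitBallVolume d)) := by
    simp only [ENNReal.mul_div_right_comm]
    exact ENNReal.Tendsto.mul_const (tendsto_comp_add_div h e) (.inr unitBallVolume_ne_top)
  refine tendsto_of_tendsto_of_tendsto_of_le_of_le (hshift (-1)) (hshift 1) (fun R => ?_)
    fun R => ?_
  · refine ENNReal.div_le_div_right ?_ _
    simpa using encard_mul_unitBallVolume_le_tsum C (R + -1)
  · exact ENNReal.div_le_div_right (tsum_le_encard_mul_unitBallVolume C R) _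

lemma coveringCount_le_encard_inter {C : Set (EuclideanSpace ℝ (Fin d))}
    (hC : (⋃ c ∈ C, Metric.ball c 1) = Set.univ) {R : ℝ} (hR : 0 ≤ R) :
    (coveringCount (cube d (-R) R) 1 : ℕ∞) ≤ (C ∩ cube d (-(R + 1)) (R + 1)).encard := by
  refine coveringCount_le_encard (cube_nonempty (neg_le_self hR)) (isCompact_cube _ _).isComplete
    (convex_cube _ _) fun y hy => ?_
  obtain ⟨c, hc, hyc⟩ := Set.mem_iUnion₂.1 (hC.ge (Set.mem_univ y))
  exact Set.mem_iUnion₂.2 ⟨c, ⟨hc, mem_cube_of_dist_lt hy hyc⟩, hyc⟩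

lemma le_of_hasDensity {C : Set (EuclideanSpace ℝ (Fin d))} {D : ℝ≥0∞}
    (hC : (⋃ c ∈ C, Metric.ball c 1) = Set.univ) (hD : HasDensity C D) :
    ENNReal.ofReal (coveringConstant d) * unitBallVolume d ≤ D := by
  have hcount := ENNReal.Tendsto.mul_const (b := unitBallVolume d)
    (ENNReal.tendsto_ofReal (tendsto_coveringCount_cube (d := d))) (.inr unitBallVolume_ne_top)
  refine le_of_tendsto_of_tendsto hcount (tendsto_comp_add_div hD (1 + 1)) ?_
  filter_upwards [eventually_gt_atTop 0] with R hR
  rw [ENNReal.ofReal_div_of_pos (by positivity), ENNReal.ofReal_natCast,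
    ← ENNReal.mul_div_right_comm, ← add_assoc]
  refine ENNReal.div_le_div_right ?_ _
  calc (coveringCount (cube d (-R) R) 1 : ℝ≥0∞) * unitBallVolume d
      ≤ ((C ∩ cube d (-(R + 1)) (R + 1)).encard : ℝ≥0∞) * unitBallVolume d := by
        gcongr
        exact_mod_cast ENat.toENNReal_le.2 (coveringCount_le_encard_inter hC hR.le)
    _ ≤ _ := encard_mul_unitBallVolume_le_tsum C (R + 1)

end Density

/-! ### Periodic families -/

section Periodic

open scoped Pointwise

variable {d : ℕ}

lemma encard_mul_volume_le {C F : Set (EuclideanSpace ℝ (Fin d))} {ρ : ℝ} (hF : MeasurableSet F)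
    (hFρ : F ⊆ Metric.ball 0 ρ) (hdisj : C.PairwiseDisjoint (· +ᵥ F)) (R : ℝ) :
    ((C ∩ cube d (-R) R).encard : ℝ≥0∞) * volume F ≤
      volume (cube d (-(R + ρ)) (R + ρ)) := by
  calc ((C ∩ cube d (-R) R).encard : ℝ≥0∞) * volume F
      = ∑' c : ↥(C ∩ cube d (-R) R), volume ((c : EuclideanSpace ℝ (Fin d)) +ᵥ F) := by
        simp only [measure_vadd, ENNReal.tsum_set_const]
    _ ≤ volume (⋃ c : ↥(C ∩ cube d (-R) R), (c : EuclideanSpace ℝ (Fin d)) +ᵥ F) :=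
        tsum_meas_le_meas_iUnion_of_disjoint _ (fun c => hF.const_vadd _)
          fun c c' h => hdisj c.2.1 c'.2.1 (Subtype.coe_ne_coe.2 h)
    _ ≤ _ := by
        refine measure_mono (Set.iUnion_subset fun c => ?_)
        rintro _ ⟨x, hx, rfl⟩
        refine mem_cube_of_dist_lt c.2.2 ?_
        simpa using hFρ hx

lemma volume_cube_le_encard_mul {C F : Set (EuclideanSpace ℝ (Fin d))} {ρ : ℝ}
    (hF : volume F ≠ 0) (hFρ : F ⊆ Metric.ball 0 ρ) (hcov : ⋃ c ∈ C, (c +ᵥ F) = Set.univ) (R : ℝ) :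
    volume (cube d (-R) R) ≤
      ((C ∩ cube d (-(R + ρ)) (R + ρ)).encard : ℝ≥0∞) * volume F := by
  obtain hfin | hinf := (C ∩ cube d (-(R + ρ)) (R + ρ)).finite_or_infinite
  · have : Countable ↥(C ∩ cube d (-(R + ρ)) (R + ρ)) := hfin.countable.to_subtype
    calc volume (cube d (-R) R)
        ≤ volume (⋃ c : ↥(C ∩ cube d (-(R + ρ)) (R + ρ)),
            (c : EuclideanSpace ℝ (Fin d)) +ᵥ F) := by
          refine measure_mono fun y hy => ?_
          obtain ⟨c, hc, x, hx, rfl⟩ := Set.mem_iUnion₂.1 (hcov.ge (Set.mem_univ y))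
          refine Set.mem_iUnion.2 ⟨⟨c, hc, mem_cube_of_dist_lt hy ?_⟩, x, hx, rfl⟩
          simpa using hFρ hx
      _ ≤ _ := measure_iUnion_le _
      _ = _ := by simp only [measure_vadd, ENNReal.tsum_set_const]
  · rw [hinf.encard_eq, ENat.toENNReal_top, ENNReal.top_mul hF]
    exact le_top

lemma hasNumberDensity_of_tiling {C F : Set (EuclideanSpace ℝ (Fin d))} (hF : MeasurableSet F)
    (hF₀ : volume F ≠ 0) (hbdd : Bornology.IsBounded F) (hdisj : C.PairwiseDisjoint (· +ᵥ F))
    (hcov : ⋃ c ∈ C, (c +ᵥ F) = Set.univ) : HasNumberDensity C (volume F)⁻¹ := by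
  obtain ⟨ρ, hρ⟩ := hbdd.subset_ball 0
  have hF_top : volume F ≠ ⊤ := hbdd.measure_lt_top.ne
  have hshift (e : ℝ) : Tendsto (fun R : ℝ => volume (cube d (-(R + e)) (R + e)) / volume F /
      ENNReal.ofReal ((2 * R) ^ d)) atTop (𝓝 (volume F)⁻¹) := by
    refine tendsto_comp_add_div (f := fun R => volume (cube d (-R) R) / volume F)
      (tendsto_const_nhds.congr' ?_) e
    filter_upwards [eventually_gt_atTop 0] with R hR
    rw [volume_cube, sub_neg_eq_add, ← two_mul, ← ENNReal.ofReal_pow (by positivity),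
      ENNReal.div_right_comm,
      ENNReal.div_self (ENNReal.ofReal_pos.2 (by positivity)).ne' (by finiteness), one_div]
  refine tendsto_of_tendsto_of_tendsto_of_le_of_le (hshift (-ρ)) (hshift ρ) (fun R => ?_)
    fun R => ?_
  · refine ENNReal.div_le_div_right (ENNReal.div_le_of_le_mul ?_) _
    simpa using volume_cube_le_encard_mul hF₀ hρ hcov (R + -ρ)
  · refine ENNReal.div_le_div_right ((ENNReal.le_div_iff_mul_le (.inl hF₀) (.inl hF_top)).2 ?_) _
    exact encard_mul_volume_le hF hρ hdisj R

variable (b : Module.Basis (Fin d) ℝ (EuclideanSpace ℝ (Fin d)))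

lemma mem_vadd_fundamentalDomain_iff {a c : EuclideanSpace ℝ (Fin d)}
    (hc : c ∈ a +ᵥ (Submodule.span ℤ (Set.range b) : Set (EuclideanSpace ℝ (Fin d))))
    (y : EuclideanSpace ℝ (Fin d)) :
    y ∈ c +ᵥ ZSpan.fundamentalDomain b ↔ c = y - ZSpan.fract b (y - a) := by
  obtain ⟨v, hv, rfl⟩ := hc
  have hsplit : -(a + v) + y = -v + (y - a) := by abel
  change y ∈ (a + v) +ᵥ ZSpan.fundamentalDomain b ↔ a + v = _
  rw [Set.mem_vadd_set_iff_neg_vadd_mem, ← ZSpan.fract_eq_self, vadd_eq_add,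
    hsplit, ZSpan.fract_zSpan_add b _ (neg_mem hv), eq_sub_iff_add_eq, ← hsplit,
    eq_neg_add_iff_add_eq]

lemma hasNumberDensity_vadd_span (a : EuclideanSpace ℝ (Fin d)) :
    HasNumberDensity (a +ᵥ (Submodule.span ℤ (Set.range b) : Set (EuclideanSpace ℝ (Fin d))))
      (volume (ZSpan.fundamentalDomain b))⁻¹ := by
  refine hasNumberDensity_of_tiling (ZSpan.fundamentalDomain_measurableSet b)
    (ZSpan.measure_fundamentalDomain_ne_zero b) (ZSpan.fundamentalDomain_isBounded b) ?_ ?_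
  · refine fun c hc c' hc' hne => Set.disjoint_left.2 fun y hy hy' => hne ?_
    rw [(mem_vadd_fundamentalDomain_iff b hc y).1 hy,
      (mem_vadd_fundamentalDomain_iff b hc' y).1 hy']
  · refine Set.eq_univ_of_forall fun y => ?_
    have hmem : y - ZSpan.fract b (y - a) ∈
        a +ᵥ (Submodule.span ℤ (Set.range b) : Set (EuclideanSpace ℝ (Fin d))) :=
      ⟨ZSpan.floor b (y - a), SetLike.coe_mem _, by simp only [ZSpan.fract, vadd_eq_add]; abel⟩
    exact Set.mem_iUnion₂.2 ⟨_, hmem, (mem_vadd_fundamentalDomain_iff b hmem y).2 rfl⟩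

lemma exists_hasNumberDensity_add {Λ : AddSubgroup (EuclideanSpace ℝ (Fin d))} {δ : ℝ≥0∞}
    (hΛ : ∀ a : EuclideanSpace ℝ (Fin d),
      HasNumberDensity (a +ᵥ (Λ : Set (EuclideanSpace ℝ (Fin d)))) δ)
    (S : Finset (EuclideanSpace ℝ (Fin d))) :
    ∃ n ≤ S.card, HasNumberDensity (S + Λ : Set (EuclideanSpace ℝ (Fin d))) (n * δ) := by
  classical
  induction S using Finset.induction with
  | empty => exact ⟨0, le_rfl, by simpa using hasNumberDensity_empty⟩
  | insert a S ha ih =>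
    obtain ⟨n, hn, hdens⟩ := ih
    have hunion : (↑(insert a S) + Λ : Set (EuclideanSpace ℝ (Fin d))) =
        (a +ᵥ (Λ : Set (EuclideanSpace ℝ (Fin d)))) ∪ (S + Λ) := by
      rw [Finset.coe_insert, Set.insert_eq, Set.union_add, Set.singleton_add]
      rfl
    rw [Finset.card_insert_of_notMem ha, hunion]
    by_cases hmem : a ∈ (S + Λ : Set (EuclideanSpace ℝ (Fin d)))
    · refine ⟨n, hn.trans (Nat.le_succ _), ?_⟩
      rwa [Set.union_eq_right.2]
      obtain ⟨x, hx, v, hv, rfl⟩ := hmem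
      rintro _ ⟨w, hw, rfl⟩
      exact ⟨x, hx, v + w, Λ.add_mem hv hw, (add_assoc x v w).symm⟩
    · refine ⟨n + 1, Nat.succ_le_succ hn, ?_⟩
      rw [Nat.cast_succ, add_one_mul, add_comm (n * δ)]
      refine (hΛ a).union hdens (Set.disjoint_left.2 ?_)
      rintro _ ⟨v, hv, rfl⟩ ⟨x, hx, w, hw, hxw⟩
      have hxw : x + w = a + v := hxw
      have ha : x + (w - v) = a := by rw [← add_sub_assoc, hxw, add_sub_cancel_right]
      exact hmem ⟨x, hx, w - v, Λ.sub_mem hw hv, ha⟩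

lemma optimalCoveringDensity_le_card_mul {S : Finset (EuclideanSpace ℝ (Fin d))}
    (hS : ZSpan.fundamentalDomain b ⊆ ⋃ c ∈ S, Metric.ball c 1) :
    optimalCoveringDensity d ≤
      S.card * (volume (ZSpan.fundamentalDomain b))⁻¹ * unitBallVolume d := by
  obtain ⟨n, hn, hdens⟩ := exists_hasNumberDensity_add
    (Λ := (Submodule.span ℤ (Set.range b)).toAddSubgroup) (hasNumberDensity_vadd_span b) S
  have hle : optimalCoveringDensity d ≤ n * (volume (ZSpan.fundamentalDomain b))⁻¹ *
      unitBallVolume d := by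
    refine sInf_le ⟨_, Set.eq_univ_of_forall fun y => ?_, hdens.hasDensity⟩
    obtain ⟨c, hc, hyc⟩ := Set.mem_iUnion₂.1 (hS (ZSpan.fract_mem_fundamentalDomain b y))
    refine Set.mem_iUnion₂.2 ⟨c + ZSpan.floor b y, Set.add_mem_add hc (SetLike.coe_mem _), ?_⟩
    rwa [Metric.mem_ball, dist_eq_norm, sub_add_eq_sub_sub_swap, ← ZSpan.fract_apply,
      ← dist_eq_norm, ← Metric.mem_ball]
  exact hle.trans (by gcongr)

variable (d) in
lemma exists_basis_fundamentalDomain_eq {L : ℝ} (hL : 0 < L) :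
    ∃ b : Module.Basis (Fin d) ℝ (EuclideanSpace ℝ (Fin d)),
      ZSpan.fundamentalDomain b = {x | ∀ i, x i ∈ Set.Ico 0 L} := by
  refine ⟨(EuclideanSpace.basisFun (Fin d) ℝ).toBasis.unitsSMul fun _ => Units.mk0 L hL.ne', ?_⟩
  ext x
  refine forall_congr' fun i => ?_
  simp [Module.Basis.repr_unitsSMul, Units.smul_def, inv_mul_lt_iff₀, hL]

lemma volume_setOf_forall_mem_Ico (a b : ℝ) :
    volume {x : EuclideanSpace ℝ (Fin d) | ∀ i, x i ∈ Set.Ico a b} =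
      ENNReal.ofReal (b - a) ^ d := by
  have hpres := (PiLp.volume_preserving_ofLp (Fin d)).measure_preimage
    (MeasurableSet.univ_pi fun _ : Fin d => measurableSet_Ico (a := a) (b := b)).nullMeasurableSet
  rw [Real.volume_pi_Ico, Finset.prod_const, Finset.card_univ, Fintype.card_fin] at hpres
  rw [← hpres]
  congr 1
  ext x
  simp

lemma optimalCoveringDensity_le {r : ℝ} (hr : 0 < r) :
    optimalCoveringDensity d ≤
      ENNReal.ofReal (r ^ d * coveringCount (cube d 0 1) r) * unitBallVolume d := by
  classical
  obtain ⟨b, hb⟩ := exists_basis_fundamentalDomain_eq d (inv_pos.2 hr)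
  obtain ⟨x, -, hx⟩ := exists_cover (totallyBounded_cube (d := d) 0 r⁻¹) one_pos
  have hcover : ZSpan.fundamentalDomain b ⊆
      ⋃ c ∈ Finset.univ.image x, Metric.ball c 1 := by
    rw [hb, Finset.set_biUnion_finset_image]
    intro y hy
    simpa using hx fun i => Set.Ico_subset_Icc_self (hy i)
  refine (optimalCoveringDensity_le_card_mul b hcover).trans ?_
  rw [hb, volume_setOf_forall_mem_Ico, sub_zero, mul_comm (r ^ d), ENNReal.ofReal_mul (by simp),
    ENNReal.ofReal_natCast, ENNReal.ofReal_inv_of_pos hr, ENNReal.inv_pow, inv_inv,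
    ENNReal.ofReal_pow hr.le]
  gcongr
  refine Finset.card_image_le.trans ?_
  rw [Finset.card_univ, Fintype.card_fin, coveringCount_cube (inv_pos.2 hr), sub_zero, one_div,
    inv_inv]

theorem optimalCoveringDensity_eq :
    optimalCoveringDensity d = ENNReal.ofReal (coveringConstant d) * unitBallVolume d := by
  refine le_antisymm ?_ (le_sInf fun D ⟨C, hC, hD⟩ => le_of_hasDensity hC hD)
  refine ge_of_tendsto (ENNReal.Tendsto.mul_const
    (ENNReal.tendsto_ofReal (tendsto_coveringCount (d := d))) (.inr unitBallVolume_ne_top)) ?_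
  filter_upwards [self_mem_nhdsWithin] with r hr using optimalCoveringDensity_le hr

lemma optimalCoveringDensity_pos : 0 < optimalCoveringDensity d := by
  rw [optimalCoveringDensity_eq]
  exact ENNReal.mul_pos (ENNReal.ofReal_pos.2 coveringConstant_pos).ne' unitBallVolume_ne_zero

lemma optimalCoveringDensity_lt_top : optimalCoveringDensity d < ⊤ := by
  rw [optimalCoveringDensity_eq]
  exact ENNReal.mul_lt_top ENNReal.ofReal_lt_top unitBallVolume_ne_top.lt_top

lemma toReal_optimalCoveringDensity_div :
    (optimalCoveringDensity d / unitBallVolume d).toReal = coveringConstant d := by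
  rw [optimalCoveringDensity_eq,
    ENNReal.mul_div_cancel_right unitBallVolume_ne_zero unitBallVolume_ne_top,
    ENNReal.toReal_ofReal coveringConstant_pos.le]

end Periodic

/-! ### Polarization constants -/

section Crowding

variable {E ι : Type*} [Fintype ι]

/-- The smoothed count of the points of the configuration `x` at distance at most about `r` from
`y`: a point at distance `ρ` is counted with weight `(1 + ρ / r) ^ (-t)`. -/
noncomputable def crowding [PseudoMetricSpace E] (t r : ℝ) (x : ι → E) (y : E) : ℝ≥0∞ :=
  ∑ j, ENNReal.ofReal ((1 + dist y (x j) / r) ^ (-t))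

lemma mul_crowding_le_of_dist_le [PseudoMetricSpace E] {t r : ℝ} (ht : 0 ≤ t) (hr : 0 < r)
    (x : ι → E) {y z : E} (h : dist y z ≤ r) :
    ENNReal.ofReal (2 ^ (-t)) * crowding t r x y ≤ crowding t r x z := by
  rw [crowding, Finset.mul_sum]
  refine Finset.sum_le_sum fun j _ => ?_
  rw [← ENNReal.ofReal_mul (by positivity), ← Real.mul_rpow (by positivity) (by positivity)]
  refine ENNReal.ofReal_le_ofReal (Real.rpow_le_rpow_of_nonpos (by positivity) ?_ (by linarith))
  have hdiv : dist z (x j) / r ≤ dist y (x j) / r + 1 := by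
    rw [div_add_one hr.ne']
    gcongr
    linarith [dist_triangle_left z (x j) y]
  have : 0 ≤ dist y (x j) / r := by positivity
  linarith

lemma rpow_neg_le_mul_one_add_div_rpow_neg {ρ r s t : ℝ} (ht : 0 ≤ t) (hts : t ≤ s) (hr : 0 < r)
    (hρ : r ≤ ρ) : ρ ^ (-s) ≤ r ^ (-s) * 2 ^ t * (1 + ρ / r) ^ (-t) := by
  set u := ρ / r with hu
  have hu1 : 1 ≤ u := (one_le_div hr).2 hρ
  calc ρ ^ (-s) = r ^ (-s) * u ^ (-s) := by
        rw [← Real.mul_rpow hr.le (by positivity), hu, mul_div_cancel₀ _ hr.ne']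
    _ ≤ r ^ (-s) * u ^ (-t) := by gcongr
    _ = r ^ (-s) * 2 ^ t * (2 * u) ^ (-t) := by
        rw [Real.mul_rpow zero_le_two (by positivity), Real.rpow_neg zero_le_two]
        field_simp
    _ ≤ r ^ (-s) * 2 ^ t * (1 + u) ^ (-t) := by
        gcongr ?_ * ?_
        exact Real.rpow_le_rpow_of_nonpos (by positivity) (by linarith) (by linarith)

lemma sum_one_div_edist_rpow_le [PseudoMetricSpace E] {r s t : ℝ} (ht : 0 ≤ t) (hts : t ≤ s)
    (hr : 0 < r) {x : ι → E} {y : E} (h : ∀ j, r ≤ dist y (x j)) :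
    ∑ j, 1 / edist y (x j) ^ s ≤ ENNReal.ofReal (r ^ (-s) * 2 ^ t) * crowding t r x y := by
  rw [crowding, Finset.mul_sum]
  refine Finset.sum_le_sum fun j _ => ?_
  rw [edist_dist, one_div, ← ENNReal.rpow_neg, ENNReal.ofReal_rpow_of_pos (hr.trans_le (h j)),
    ← ENNReal.ofReal_mul (by positivity)]
  exact ENNReal.ofReal_le_ofReal (rpow_neg_le_mul_one_add_div_rpow_neg ht hts hr (h j))

lemma packingNumber_mul_le_lintegral [PseudoMetricSpace E] [MeasurableSpace E]
    [OpensMeasurableSpace E] (μ : Measure E) {f : E → ℝ≥0∞} {Y : Set E} {ε : ℝ≥0} {m v : ℝ≥0∞}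
    (hm : ∀ y ∈ Y, ∀ z ∈ Metric.ball y (ε / 2), m ≤ f z)
    (hv : ∀ y ∈ Y, v ≤ μ (Metric.ball y (ε / 2))) :
    (Metric.packingNumber ε Y : ℝ≥0∞) * (m * v) ≤ ∫⁻ z, f z ∂μ := by
  simp only [Metric.packingNumber, ENat.toENNReal_iSup, ENNReal.iSup_mul]
  refine iSup_le fun C => iSup_le fun hCY => iSup_le fun hC => ?_
  have hdisj : Pairwise (Function.onFun Disjoint fun y : C => Metric.ball (y : E) (ε / 2)) := by
    intro y z hyz
    refine Metric.ball_disjoint_ball ?_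
    have hε : (ε : ℝ≥0∞) < edist (y : E) z := hC y.2 z.2 (Subtype.coe_ne_coe.2 hyz)
    rw [edist_nndist, ENNReal.coe_lt_coe] at hε
    rw [add_halves]
    exact_mod_cast hε.le
  calc (C.encard : ℝ≥0∞) * (m * v) = ∑' _ : C, m * v := by
        rw [ENNReal.tsum_const, Set.encard]
    _ ≤ ∑' y : C, μ.withDensity f (Metric.ball (y : E) (ε / 2)) := by
        refine ENNReal.tsum_le_tsum fun y => ?_
        rw [withDensity_apply _ measurableSet_ball]
        calc m * v ≤ m * μ (Metric.ball (y : E) (ε / 2)) := by gcongr; exact hv y (hCY y.2)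
          _ = ∫⁻ _ in Metric.ball (y : E) (ε / 2), m ∂μ := (setLIntegral_const _ _).symm
          _ ≤ ∫⁻ z in Metric.ball (y : E) (ε / 2), f z ∂μ :=
              setLIntegral_mono' measurableSet_ball (hm y (hCY y.2))
    _ ≤ μ.withDensity f (⋃ y : C, Metric.ball (y : E) (ε / 2)) :=
        tsum_meas_le_meas_iUnion_of_disjoint _ (fun _ => measurableSet_ball) hdisj
    _ ≤ μ.withDensity f Set.univ := measure_mono (Set.subset_univ _)
    _ = ∫⁻ z, f z ∂μ := by rw [withDensity_apply _ .univ, setLIntegral_univ]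

lemma polarization_le_of_crowding_le [MetricSpace E] {A : Set E} {N : ℕ} {K r s t : ℝ}
    (ht : 0 ≤ t) (hts : t ≤ s) (hr : 0 < r)
    (h : ∀ x : Fin N → A, ∃ y ∈ A, (∀ j, r ≤ dist y (x j)) ∧
      crowding t r (fun j => (x j : E)) y ≤ ENNReal.ofReal K) :
    polarization s A N ≤ ENNReal.ofReal (r ^ (-s) * 2 ^ t * K) := by
  refine iSup_le fun x => ?_
  obtain ⟨y, hy, hfar, hcrowd⟩ := h x
  calc configPolarization s A x ≤ ∑ j, 1 / edist y (x j : E) ^ s :=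
        iInf_le (fun y : A => ∑ j, 1 / edist (y : E) (x j : E) ^ s) ⟨y, hy⟩
    _ ≤ ENNReal.ofReal (r ^ (-s) * 2 ^ t) * crowding t r (fun j => (x j : E)) y :=
        sum_one_div_edist_rpow_le ht hts hr hfar
    _ ≤ ENNReal.ofReal (r ^ (-s) * 2 ^ t * K) := by
        rw [ENNReal.ofReal_mul (q := K) (by positivity)]
        gcongr

end Crowding

section DeepHole

variable {E ι : Type*} [Fintype ι] [MetricSpace E] {A Y : Set E} {r : ℝ}

lemma coveringCount_le_card_add_coveringNumber (x : ι → A) (hYA : Y ⊆ A) {ε : ℝ≥0} (hε : ε < r)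
    (hY : ∀ y ∈ A, (∀ j, r ≤ dist y (x j)) → y ∈ Y) :
    (coveringCount A r : ℕ∞) ≤ Fintype.card ι + Metric.coveringNumber ε Y := by
  obtain htop | hfin := eq_or_ne (Metric.coveringNumber ε Y) ⊤
  · simp [htop]
  obtain ⟨C, hCY, hC, hcover, hcard⟩ := Metric.exists_set_encard_eq_coveringNumber hfin
  rw [Metric.isCover_iff_subset_iUnion_closedBall] at hcover
  have := hC.fintype
  let x' : ι ⊕ C → E := Sum.elim (fun j => x j) fun c => c
  have hx' : A ⊆ ⋃ k, Metric.ball (x' k) r := by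
    intro y hy
    by_cases hfar : ∀ j, r ≤ dist y (x j)
    · obtain ⟨c, hc, hyc⟩ := Set.mem_iUnion₂.1 (hcover (hY y hy hfar))
      exact Set.mem_iUnion.2 ⟨.inr ⟨c, hc⟩, (Metric.mem_closedBall.1 hyc).trans_lt hε⟩
    · push Not at hfar
      obtain ⟨j, hj⟩ := hfar
      exact Set.mem_iUnion.2 ⟨.inl j, hj⟩
  have hle := coveringCount_le_card x' (Sum.forall.2 ⟨fun j => (x j).2, fun c => hYA (hCY c.2)⟩) hx'
  rw [← hcard, ← Set.coe_fintypeCard]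
  rw [Fintype.card_sum] at hle
  exact_mod_cast hle

end DeepHole

section HaarMeasure

open Module

variable {E ι : Type*} [Fintype ι] [NormedAddCommGroup E] [NormedSpace ℝ E] [FiniteDimensional ℝ E]

section AddHaar

variable [MeasurableSpace E] [BorelSpace E] (μ : Measure E) [μ.IsAddHaarMeasure]

lemma lintegral_one_add_norm_div_rpow (t : ℝ) {r : ℝ} (hr : 0 < r) :
    ∫⁻ z, ENNReal.ofReal ((1 + ‖z‖ / r) ^ (-t)) ∂μ =
      ENNReal.ofReal (r ^ finrank ℝ E) * ∫⁻ z, ENNReal.ofReal ((1 + ‖z‖) ^ (-t)) ∂μ := by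
  have hnorm (z : E) : ‖z‖ / r = ‖r⁻¹ • z‖ := by
    rw [norm_smul, Real.norm_of_nonneg (by positivity), div_eq_inv_mul]
  simp only [hnorm]
  rw [← lintegral_map (f := fun z : E => ENNReal.ofReal ((1 + ‖z‖) ^ (-t))) (by fun_prop)
    (by fun_prop), Measure.map_addHaar_smul μ (inv_ne_zero hr.ne'), lintegral_smul_measure,
    inv_pow, inv_inv, abs_of_pos (by positivity), smul_eq_mul]

lemma lintegral_crowding (t : ℝ) {r : ℝ} (hr : 0 < r) (x : ι → E) :
    ∫⁻ z, crowding t r x z ∂μ = Fintype.card ι *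
      (ENNReal.ofReal (r ^ finrank ℝ E) * ∫⁻ z, ENNReal.ofReal ((1 + ‖z‖) ^ (-t)) ∂μ) := by
  simp only [crowding, dist_eq_norm]
  rw [lintegral_finsetSum _ fun j _ => by fun_prop]
  simp only [lintegral_sub_right_eq_self fun z => ENNReal.ofReal ((1 + ‖z‖ / r) ^ (-t)),
    lintegral_one_add_norm_div_rpow μ t hr]
  simp

lemma coveringNumber_mul_le_of_le_crowding {t : ℝ} (ht : 0 ≤ t) {r : ℝ≥0} (hr : 0 < r)
    {x : ι → E} {Y : Set E} {K : ℝ≥0∞} (hK : ∀ y ∈ Y, K ≤ crowding t r x y) :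
    (Metric.coveringNumber (r / 2) Y : ℝ≥0∞) *
        (ENNReal.ofReal (2 ^ (-t) * (1 / 4) ^ finrank ℝ E) * μ (Metric.ball 0 1) * K) ≤
      Fintype.card ι * ∫⁻ z, ENNReal.ofReal ((1 + ‖z‖) ^ (-t)) ∂μ := by
  have hr' : (0 : ℝ) < r := hr
  have hrn : ENNReal.ofReal ((r : ℝ) ^ finrank ℝ E) ≠ 0 :=
    (ENNReal.ofReal_pos.2 (by positivity)).ne'
  have hball (y : E) : μ (Metric.ball y ((r / 2 : ℝ≥0) / 2)) =
      ENNReal.ofReal ((r : ℝ) ^ finrank ℝ E) *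
        (ENNReal.ofReal ((1 / 4) ^ finrank ℝ E) * μ (Metric.ball 0 1)) := by
    rw [Measure.addHaar_ball_of_pos μ y (by positivity), ← mul_assoc,
      ← ENNReal.ofReal_mul (by positivity), ← mul_pow]
    congr 3
    push_cast
    ring
  have hcrowd (y) (hy : y ∈ Y) (z) (hz : z ∈ Metric.ball y ((r / 2 : ℝ≥0) / 2)) :
      ENNReal.ofReal (2 ^ (-t)) * K ≤ crowding t r x z := by
    have hyz : dist y z ≤ r := by
      rw [dist_comm]
      refine (Metric.mem_ball.1 hz).le.trans ?_
      push_cast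
      linarith
    exact (mul_le_mul_right (hK y hy) _).trans (mul_crowding_le_of_dist_le ht hr' x hyz)
  refine (ENNReal.mul_le_mul_iff_right hrn ENNReal.ofReal_ne_top).1 ?_
  calc ENNReal.ofReal ((r : ℝ) ^ finrank ℝ E) * ((Metric.coveringNumber (r / 2) Y : ℝ≥0∞) *
        (ENNReal.ofReal (2 ^ (-t) * (1 / 4) ^ finrank ℝ E) * μ (Metric.ball 0 1) * K))
      ≤ ENNReal.ofReal ((r : ℝ) ^ finrank ℝ E) * ((Metric.packingNumber (r / 2) Y : ℝ≥0∞) *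
        (ENNReal.ofReal (2 ^ (-t) * (1 / 4) ^ finrank ℝ E) * μ (Metric.ball 0 1) * K)) := by
        gcongr
        exact Metric.coveringNumber_le_packingNumber _ _
    _ = (Metric.packingNumber (r / 2) Y : ℝ≥0∞) * (ENNReal.ofReal (2 ^ (-t)) * K *
        (ENNReal.ofReal ((r : ℝ) ^ finrank ℝ E) *
          (ENNReal.ofReal ((1 / 4) ^ finrank ℝ E) * μ (Metric.ball 0 1)))) := by
        rw [ENNReal.ofReal_mul (by positivity)]
        ring
    _ ≤ ∫⁻ z, crowding t r x z ∂μ :=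
        packingNumber_mul_le_lintegral μ hcrowd fun y _ => (hball y).ge
    _ = ENNReal.ofReal ((r : ℝ) ^ finrank ℝ E) *
        (Fintype.card ι * ∫⁻ z, ENNReal.ofReal ((1 + ‖z‖) ^ (-t)) ∂μ) := by
        rw [lintegral_crowding μ t hr']
        ring

end AddHaar

lemma exists_coveringNumber_le_of_le_crowding {t : ℝ} (ht : finrank ℝ E < t) {δ : ℝ}
    (hδ : 0 < δ) :
    ∃ K : ℝ, 0 < K ∧ ∀ {N : ℕ} (x : Fin N → E) {r : ℝ≥0}, 0 < r → ∀ {Y : Set E},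
      (∀ y ∈ Y, ENNReal.ofReal K ≤ crowding t r x y) →
        (Metric.coveringNumber (r / 2) Y : ℝ≥0∞) ≤ ENNReal.ofReal δ * N := by
  let _ : MeasurableSpace E := borel E
  have _ : BorelSpace E := ⟨rfl⟩
  let μ : Measure E := Measure.addHaar
  have ht0 : 0 ≤ t := (Nat.cast_nonneg _).trans ht.le
  set c := ENNReal.ofReal (2 ^ (-t) * (1 / 4) ^ finrank ℝ E) * μ (Metric.ball 0 1)
  set I := ∫⁻ z, ENNReal.ofReal ((1 + ‖z‖) ^ (-t)) ∂μ
  have hI : I ≠ ⊤ := (finite_integral_one_add_norm ht).ne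
  have hc : c ≠ 0 := mul_ne_zero (ENNReal.ofReal_pos.2 (by positivity)).ne'
    (Metric.measure_ball_pos μ 0 one_pos).ne'
  have hc' : c ≠ ⊤ := ENNReal.mul_ne_top ENNReal.ofReal_ne_top measure_ball_lt_top.ne
  have hδ' : ENNReal.ofReal δ ≠ 0 := (ENNReal.ofReal_pos.2 hδ).ne'
  have hK : (I + 1) / (c * ENNReal.ofReal δ) ≠ 0 :=
    ENNReal.div_ne_zero.2 ⟨by simp, by finiteness⟩
  have hK' : (I + 1) / (c * ENNReal.ofReal δ) ≠ ⊤ :=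
    ENNReal.div_ne_top (by finiteness) (mul_ne_zero hc hδ')
  refine ⟨((I + 1) / (c * ENNReal.ofReal δ)).toReal, ENNReal.toReal_pos hK hK',
    fun {N} x {r} hr {Y} hY => ?_⟩
  rw [ENNReal.ofReal_toReal hK'] at hY
  have hcount := coveringNumber_mul_le_of_le_crowding μ ht0 hr hY
  rw [ENNReal.div_eq_inv_mul, ENNReal.mul_inv (.inl hc) (.inl hc'), mul_assoc c⁻¹,
    ENNReal.mul_inv_cancel_left hc hc', Fintype.card_fin, ← ENNReal.div_eq_inv_mul, ← mul_div_assoc,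
    ENNReal.div_le_iff hδ' ENNReal.ofReal_ne_top] at hcount
  refine (ENNReal.mul_le_mul_iff_left (c := I + 1) (by simp) (by finiteness)).1 ?_
  calc (Metric.coveringNumber (r / 2) Y : ℝ≥0∞) * (I + 1)
      ≤ N * I * ENNReal.ofReal δ := hcount
    _ ≤ N * (I + 1) * ENNReal.ofReal δ := by gcongr; exact le_self_add
    _ = ENNReal.ofReal δ * N * (I + 1) := by ring

lemma exists_forall_le_dist_and_crowding_le {t : ℝ} (ht : finrank ℝ E < t) {δ : ℝ} (hδ : 0 < δ) :
    ∃ K : ℝ, 0 < K ∧ ∀ {A : Set E} {N : ℕ} (x : Fin N → A) {r : ℝ}, 0 < r →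
      (1 + δ) * N < coveringCount A r →
      ∃ y ∈ A, (∀ j, r ≤ dist y (x j)) ∧
        crowding t r (fun j => (x j : E)) y ≤ ENNReal.ofReal K := by
  obtain ⟨K, hK, hcrowded⟩ := exists_coveringNumber_le_of_le_crowding ht hδ
  refine ⟨K, hK, fun {A N} x {r} hr hN => ?_⟩
  by_contra! hfar
  lift r to ℝ≥0 using hr.le
  let Y : Set E := {y ∈ A | ENNReal.ofReal K ≤ crowding t r (fun j => (x j : E)) y}
  have hY : (Metric.coveringNumber (r / 2) Y : ℝ≥0∞) ≤ ENNReal.ofReal δ * N :=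
    hcrowded _ (by exact_mod_cast hr) fun y hy => hy.2
  have hcount : (coveringCount A r : ℕ∞) ≤ Fintype.card (Fin N) + Metric.coveringNumber (r / 2) Y :=
    coveringCount_le_card_add_coveringNumber x (Set.sep_subset _ _)
      (by exact_mod_cast half_lt_self hr) fun y hy hxy => ⟨hy, (hfar y hy hxy).le⟩
  rw [Fintype.card_fin, ← ENat.toENNReal_le] at hcount
  push_cast at hcount
  have hle : ENNReal.ofReal (coveringCount A r) ≤ ENNReal.ofReal ((1 + δ) * N) := by
    calc ENNReal.ofReal (coveringCount A r) = coveringCount A r := ENNReal.ofReal_natCast _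
      _ ≤ N + ENNReal.ofReal δ * N := hcount.trans (by gcongr)
      _ = ENNReal.ofReal ((1 + δ) * N) := by
        rw [ENNReal.ofReal_mul (by positivity), ENNReal.ofReal_add zero_le_one hδ.le, add_mul,
          ENNReal.ofReal_one, one_mul, ENNReal.ofReal_natCast]
  exact hN.not_ge ((ENNReal.ofReal_le_ofReal_iff (by positivity)).1 hle)

lemma exists_polarization_le {A : Set E} {t θ q : ℝ} (hE : finrank ℝ E ≠ 0) (ht : finrank ℝ E < t)
    (hθ : ∀ r > 0, θ ≤ r ^ finrank ℝ E * coveringCount A r) (hq : 0 < q) (hqθ : q < θ) :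
    ∃ K : ℝ, 0 < K ∧ ∀ s, t ≤ s → ∀ N : ℕ, 0 < N →
      polarization s A N / (N : ℝ≥0∞) ^ (s / (finrank ℝ E : ℝ)) ≤
        ENNReal.ofReal (K * q ^ (-(s / finrank ℝ E))) := by
  have ht0 : 0 ≤ t := (Nat.cast_nonneg _).trans ht.le
  set n := finrank ℝ E
  obtain ⟨q', hqq', hq'⟩ := exists_between hqθ
  obtain ⟨K, hK, hhole⟩ := exists_forall_le_dist_and_crowding_le ht (δ := q' / q - 1)
    (sub_pos.2 ((one_lt_div hq).2 hqq'))
  refine ⟨2 ^ t * K, by positivity, fun s hs N hN => ?_⟩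
  have hN' : (0 : ℝ) < N := by exact_mod_cast hN
  set r := (q / N) ^ (n : ℝ)⁻¹ with hr_def
  have hr : 0 < r := by positivity
  have hrn : r ^ n = q / N := Real.rpow_inv_natCast_pow (by positivity) hE
  have hrs : r ^ (-s) / (N : ℝ) ^ (s / n) = q ^ (-(s / n)) := by
    rw [hr_def, ← Real.rpow_mul (by positivity), inv_mul_eq_div, neg_div,
      Real.div_rpow hq.le hN'.le, Real.rpow_neg hN'.le]
    field_simp
  have hfew : (1 + (q' / q - 1)) * N < coveringCount A r := by
    have hθr := hθ r hr
    rw [hrn] at hθr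
    calc (1 + (q' / q - 1)) * N = q' * (N / q) := by ring
      _ < q / N * coveringCount A r * (N / q) := by
        gcongr
        exact hq'.trans_le hθr
      _ = coveringCount A r := by field_simp
  have hpol := polarization_le_of_crowding_le ht0 hs hr fun x => hhole x hr hfew
  refine (ENNReal.div_le_div_right hpol _).trans_eq ?_
  rw [natCast_rpow hN, ← ENNReal.ofReal_div_of_pos (by positivity), ← hrs]
  congr 1
  ring

end HaarMeasure

section Sigma

variable {d : ℕ} {r s t q : ℝ}

lemma ofReal_rpow_neg_le_polarization {E : Type*} [MetricSpace E] {A : Set E}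
    (hA : TotallyBounded A) (hne : A.Nonempty) (hs : 0 ≤ s) (hr : 0 < r) {N : ℕ}
    (hN : coveringCount A r ≤ N) : ENNReal.ofReal (r ^ (-s)) ≤ polarization s A N := by
  obtain ⟨x, hx⟩ := exists_config hA hne hr hN
  refine le_iSup_of_le x (le_iInf fun y => ?_)
  obtain ⟨j, hj⟩ := hx y y.2
  calc ENNReal.ofReal (r ^ (-s)) = 1 / ENNReal.ofReal r ^ s := by
        rw [one_div, ← ENNReal.rpow_neg, ENNReal.ofReal_rpow_of_pos hr]
    _ ≤ 1 / edist (y : E) (x j : E) ^ s := by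
        rw [edist_dist]
        gcongr
    _ ≤ ∑ j, 1 / edist (y : E) (x j : E) ^ s :=
        Finset.single_le_sum (f := fun j => 1 / edist (y : E) (x j : E) ^ s)
          (fun _ _ => zero_le) (Finset.mem_univ j)

lemma tendsto_polarization_iSup (hd : d ≠ 0) (hs : 0 ≤ s) :
    Tendsto (fun N : ℕ => polarization s (cube d 0 1) N / (N : ℝ≥0∞) ^ (s / (d : ℝ))) atTop
      (𝓝 (⨆ N : ℕ, polarization s (cube d 0 1) N / (N : ℝ≥0∞) ^ (s / (d : ℝ)))) := by
  have hne : (cube d 0 1).Nonempty := cube_nonempty zero_le_one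
  refine tendsto_div_rpow_iSup_of_scaling hd hs (polarization_zero hne s)
    (polarization_mono hne s) fun k hk M => ?_
  have hscale := (isSelfSimilar_cube (d := d) hk).mul_polarization_le (by positivity) hs M
  rwa [Real.inv_rpow k.cast_nonneg, Real.rpow_neg k.cast_nonneg, inv_inv, Fintype.card_pi_const,
    Fintype.card_fin] at hscale

lemma sigma_eq_iSup (hd : d ≠ 0) (hs : 0 ≤ s) :
    sigma s d = ⨆ N : ℕ, polarization s (cube d 0 1) N / (N : ℝ≥0∞) ^ (s / (d : ℝ)) :=
  (tendsto_polarization_iSup hd hs).limUnder_eq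

theorem tendsto_polarization_sigma (hd : d ≠ 0) (hs : 0 ≤ s) :
    Tendsto (fun N : ℕ => polarization s (cube d 0 1) N / (N : ℝ≥0∞) ^ (s / (d : ℝ))) atTop
      (𝓝 (sigma s d)) :=
  sigma_eq_iSup hd hs ▸ tendsto_polarization_iSup hd hs

lemma ofReal_rpow_neg_le_sigma (hd : d ≠ 0) (hs : 0 ≤ s) (hr : 0 < r) :
    ENNReal.ofReal ((r ^ d * coveringCount (cube d 0 1) r) ^ (-(s / d))) ≤ sigma s d := by
  have hA : TotallyBounded (cube d 0 1) := totallyBounded_cube 0 1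
  have hne : (cube d 0 1).Nonempty := cube_nonempty zero_le_one
  set N := coveringCount (cube d 0 1) r
  have hN : 0 < N := coveringCount_pos hA hne hr
  have hrs : (r ^ d) ^ (-(s / d)) = r ^ (-s) := by
    rw [← Real.rpow_natCast, ← Real.rpow_mul hr.le]
    congr 1
    field_simp
  calc ENNReal.ofReal ((r ^ d * N) ^ (-(s / d)))
      = ENNReal.ofReal (r ^ (-s)) / (N : ℝ≥0∞) ^ (s / (d : ℝ)) := by
        rw [natCast_rpow hN, ← ENNReal.ofReal_div_of_pos (by positivity),
          Real.mul_rpow (by positivity) N.cast_nonneg, hrs, Real.rpow_neg N.cast_nonneg,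
          ← div_eq_mul_inv]
    _ ≤ polarization s (cube d 0 1) N / (N : ℝ≥0∞) ^ (s / (d : ℝ)) := by
        gcongr
        exact ofReal_rpow_neg_le_polarization hA hne hs hr le_rfl
    _ ≤ sigma s d := by
        rw [sigma_eq_iSup hd hs]
        exact le_iSup (fun N : ℕ => polarization s (cube d 0 1) N / (N : ℝ≥0∞) ^ (s / (d : ℝ))) N

lemma exists_sigma_le (hd : d ≠ 0) (ht : d < t) (hq : 0 < q) (hqθ : q < coveringConstant d) :
    ∃ K : ℝ, 0 < K ∧ ∀ s, t ≤ s → sigma s d ≤ ENNReal.ofReal (K * q ^ (-(s / d))) := by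
  have hfinrank : Module.finrank ℝ (EuclideanSpace ℝ (Fin d)) = d := finrank_euclideanSpace_fin
  obtain ⟨K, hK, h⟩ := exists_polarization_le (A := cube d 0 1) (hfinrank.trans_ne hd)
    (by rwa [hfinrank]) (fun r hr => by rw [hfinrank]; exact coveringConstant_le hr) hq hqθ
  rw [hfinrank] at h
  refine ⟨K, hK, fun s hs => ?_⟩
  rw [sigma_eq_iSup hd ((Nat.cast_nonneg d).trans (ht.le.trans hs))]
  refine iSup_le fun N => ?_
  obtain rfl | hN := N.eq_zero_or_pos
  · simp [polarization_zero (cube_nonempty (d := d) zero_le_one)]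
  · exact h s hs N hN

lemma sigma_pos (hd : d ≠ 0) (hs : 0 ≤ s) : 0 < sigma s d := by
  refine (ENNReal.ofReal_pos.2 (Real.rpow_pos_of_pos ?_ _)).trans_le
    (ofReal_rpow_neg_le_sigma hd hs one_pos)
  exact coveringConstant_pos.trans_le (coveringConstant_le one_pos)

lemma sigma_lt_top (hd : d ≠ 0) (hs : d < s) : sigma s d < ⊤ := by
  obtain ⟨K, -, h⟩ := exists_sigma_le hd hs (half_pos coveringConstant_pos)
    (half_lt_self coveringConstant_pos)
  exact (h s le_rfl).trans_lt ENNReal.ofReal_lt_top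

lemma rpow_neg_div_rpow_neg_div {a : ℝ} (ha : 0 ≤ a) {p : ℝ} (hp : p ≠ 0) (hs : s ≠ 0) :
    (a ^ (-(s / p))) ^ (-p / s) = a := by
  rw [← Real.rpow_mul ha, show -(s / p) * (-p / s) = 1 by field_simp, Real.rpow_one]

lemma toReal_sigma_rpow_le (hd : d ≠ 0) (hs : d < s) :
    (sigma s d).toReal ^ (-(d : ℝ) / s) ≤ coveringConstant d := by
  have hd' : (d : ℝ) ≠ 0 := by exact_mod_cast hd
  have hs0 : 0 < s := (Nat.cast_nonneg d).trans_lt hs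
  refine le_ciInf fun ⟨r, hr⟩ => ?_
  have hpos := coveringConstant_pos.trans_le (coveringConstant_le (d := d) hr)
  have hle := (ENNReal.ofReal_le_iff_le_toReal (sigma_lt_top hd hs).ne).1
    (ofReal_rpow_neg_le_sigma hd hs0.le hr)
  calc (sigma s d).toReal ^ (-(d : ℝ) / s)
      ≤ ((r ^ d * coveringCount (cube d 0 1) r) ^ (-(s / d))) ^ (-(d : ℝ) / s) :=
        Real.rpow_le_rpow_of_nonpos (by positivity) hle
          (div_nonpos_of_nonpos_of_nonneg (by simp) hs0.le)
    _ = r ^ d * coveringCount (cube d 0 1) r := rpow_neg_div_rpow_neg_div hpos.le hd' hs0.ne'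

lemma exists_le_toReal_sigma_rpow (hd : d ≠ 0) (hq : 0 < q) (hqθ : q < coveringConstant d) :
    ∃ K : ℝ, 0 < K ∧ ∀ s : ℝ, d + 1 ≤ s →
      K ^ (-(d : ℝ) / s) * q ≤ (sigma s d).toReal ^ (-(d : ℝ) / s) := by
  have hd' : (d : ℝ) ≠ 0 := by exact_mod_cast hd
  obtain ⟨K, hK, h⟩ := exists_sigma_le hd (lt_add_one (d : ℝ)) hq hqθ
  refine ⟨K, hK, fun s hs => ?_⟩
  have hds : d < s := (lt_add_one _).trans_le hs
  have hs0 : 0 < s := (Nat.cast_nonneg d).trans_lt hds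
  calc K ^ (-(d : ℝ) / s) * q = (K * q ^ (-(s / d))) ^ (-(d : ℝ) / s) := by
        rw [Real.mul_rpow hK.le (by positivity), rpow_neg_div_rpow_neg_div hq.le hd' hs0.ne']
    _ ≤ (sigma s d).toReal ^ (-(d : ℝ) / s) :=
        Real.rpow_le_rpow_of_nonpos
          (ENNReal.toReal_pos (sigma_pos hd hs0.le).ne' (sigma_lt_top hd hds).ne)
          (ENNReal.toReal_le_of_le_ofReal (by positivity) (h s hs))
          (div_nonpos_of_nonpos_of_nonneg (by simp) hs0.le)

theorem tendsto_toReal_sigma_rpow (hd : d ≠ 0) :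
    Tendsto (fun s : ℝ => (sigma s d).toReal ^ (-(d : ℝ) / s)) atTop
      (𝓝 (coveringConstant d)) := by
  refine tendsto_order.2 ⟨fun c hc => ?_, fun c hc => ?_⟩
  · obtain ⟨q, hq, hqθ⟩ := exists_between (max_lt hc coveringConstant_pos)
    obtain ⟨hcq, hq0⟩ := max_lt_iff.1 hq
    obtain ⟨K, hK, h⟩ := exists_le_toReal_sigma_rpow hd hq0 hqθ
    have hlim : Tendsto (fun s : ℝ => K ^ (-(d : ℝ) / s) * q) atTop (𝓝 (K ^ (0 : ℝ) * q)) :=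
      (tendsto_const_nhds.rpow (tendsto_const_nhds.div_atTop tendsto_id) (.inl hK.ne')).mul_const q
    rw [Real.rpow_zero, one_mul] at hlim
    filter_upwards [hlim.eventually_const_lt hcq, eventually_ge_atTop ((d : ℝ) + 1)] with s hcs hs
    exact hcs.trans_le (h s hs)
  · filter_upwards [eventually_gt_atTop (d : ℝ)] with s hs
    exact (toReal_sigma_rpow_le hd hs).trans_lt hc

end Sigma

end RieszCovering

theorem mainTheorem8 (d : ℕ) (hd : 1 ≤ d) :
    -- `Γ_d` is positive and finite
    (0 < RieszCovering.optimalCoveringDensity d ∧ RieszCovering.optimalCoveringDensity d < ⊤) ∧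
    -- for `s > d` the limit defining `σ_{s,d}` exists, and it is positive and finite
    (∀ s : ℝ, (d : ℝ) < s →
      Tendsto
        (fun N : ℕ => RieszCovering.polarization s (RieszCovering.cube d 0 1) N /
          (N : ℝ≥0∞) ^ (s / (d : ℝ)))
        atTop (𝓝 (RieszCovering.sigma s d)) ∧
      0 < RieszCovering.sigma s d ∧ RieszCovering.sigma s d < ⊤) ∧
    Tendsto
      (fun R : ℝ => (RieszCovering.coveringCount (RieszCovering.cube d (-R) R) 1 : ℝ) / (2 * R) ^ d)
      atTop
      (𝓝 (RieszCovering.optimalCoveringDensity d / RieszCovering.unitBallVolume d).toReal) ∧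
    Tendsto
      (fun r : ℝ => r ^ d * (RieszCovering.coveringCount (RieszCovering.cube d 0 1) r : ℝ))
      (𝓝[>] 0)
      (𝓝 (RieszCovering.optimalCoveringDensity d / RieszCovering.unitBallVolume d).toReal) ∧
    Tendsto
      (fun N : ℕ => (N : ℝ) * RieszCovering.coveringRadius (RieszCovering.cube d 0 1) N ^ d)
      atTop
      (𝓝 (RieszCovering.optimalCoveringDensity d / RieszCovering.unitBallVolume d).toReal) ∧
    Tendsto
      (fun s : ℝ => (RieszCovering.sigma s d).toReal ^ (-(d : ℝ) / s))
      atTop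
      (𝓝 (RieszCovering.optimalCoveringDensity d / RieszCovering.unitBallVolume d).toReal) := by
  have hd0 : d ≠ 0 := Nat.one_le_iff_ne_zero.1 hd
  rw [RieszCovering.toReal_optimalCoveringDensity_div]
  refine ⟨⟨RieszCovering.optimalCoveringDensity_pos, RieszCovering.optimalCoveringDensity_lt_top⟩,
    fun s hs => ?_, RieszCovering.tendsto_coveringCount_cube, RieszCovering.tendsto_coveringCount,
    RieszCovering.tendsto_mul_coveringRadius_pow (RieszCovering.totallyBounded_cube 0 1)
      (RieszCovering.cube_nonempty zero_le_one) hd0 RieszCovering.tendsto_coveringCount,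
    RieszCovering.tendsto_toReal_sigma_rpow hd0⟩
  have hs0 : 0 ≤ s := (Nat.cast_nonneg d).trans hs.le
  exact ⟨RieszCovering.tendsto_polarization_sigma hd0 hs0, RieszCovering.sigma_pos hd0 hs0,
    RieszCovering.sigma_lt_top hd0 hs⟩
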